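/- Let $n,M,d\ge 1$, $L\ge 2$ be integers, $P,\sigma>0$, $v=P/\sigma^2$, and let $R=\frac{L\ln M}{n}$ be the transmission rate in nats. Index the coordinates of $\mathbb{R}^{N}$, $N=LM$, by $L$ sections of size $M$ each, and let $\mathcal B\subset\{0,1\}^N$ be the set of vectors with exactly one entry $1$ in each section. Let $X\in\mathbb{R}^{n\times N}$ be a random matrix with independent entries, each of which is a sum of $d$ independent random variables taking the values $\pm\sqrt{P/(dL)}$ with probability $1/2$ each (binomial dictionary with $d$ trials), and let $\epsilon\in\mathbb{R}^n$ be independent of $X$ with independent $N(0,\sigma^2)$ coordinates. For a sent $\beta\in\mathcal B$ put $Y=X\beta+\epsilon$, let $\hat\beta=\hat\beta(X,Y)\in\arg\min_{\beta'\in\mathcal B}\|Y-X\beta'\|^2$ (ties broken in any way), and let $E_l$ be the event that $\hat\beta$ and $\beta$ differ in exactly $l$ sections; $\mathbb{P}_\beta$ denotes the joint law of $X$ and $\epsilon$ for this $\beta$. For $\alpha\in[0,1]$ put $C_\alpha=\frac12\ln(1+\alpha v)$, and for $\Delta\ge0$ and $0\le q<1$ put $$D(\Delta,q)=\max_{\lambda\ge0,\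 \lambda^2q<1}\Bigl\{\lambda\Delta+\tfrac12\ln(1-\lambda^2q)\Bigr\}\ (q>0),\qquad D_1(\Delta,q)=\max_{0\le\lambda\le1}\Bigl\{\lambda\Delta+\tfrac12\ln(1-\lambda^2q)\Bigr\}.$$ Let $\eta=\sqrt{9/(8\pi e)}$ and, for integers $k\ge1$, $\phi(k)=\inf_{\zeta\in(0,1/2)}\phi_\zeta(k)$, where $$\phi_\zeta(k)=\max\Bigl\{\bigl(\tfrac{3}{16}c_\zeta^2+\tfrac1{12}\bigr)\tfrac1k,\ -\tfrac{4\zeta^4}{3}k+\ln\tfrac k2+\tfrac1{12k},\ -\bigl(\ln2-\tfrac12\bigr)k+\tfrac12\ln\tfrac{\pi k}{2}\Bigr\},\quad c_\zeta=\tfrac1{(1+2\zeta)^2}+\tfrac1{(1-2\zeta)^2}.$$ Let $\alpha_0\in(0,1]$, and define $\iota_1=\ln\bigl((1+\iota_3)(1+\max\{\iota_4,\iota_5\})\bigr)$ and $\iota_2=\phi(dL)+\ln\bigl(1+\frac{2\eta}{dL}\bigr)$, where $$1+\iota_3=\max_{\alpha_0L\le k\le L}e^{\phi(dk)}\Bigl(1+\frac{\eta(1+v)}{dk}\Bigr),$$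 $$1+\iota_4=\max_{\alpha_0L\le k\le L-\sqrt{L/d}}e^{\phi(dk)+\phi(d(L-k))}\Bigl(1+\frac{\eta}{dk}\Bigr)\Bigl(1+\frac{\eta}{d(L-k)}\Bigr),$$ $$1+\iota_5=\max_{L-\sqrt{L/d}\le k\le L-1}\frac{e^{\phi(dk)}}{\sqrt{1-1/\sqrt{dL}}}\Bigl(1+\frac{\eta}{dk}\Bigr),$$ the maxima being over integers $k$, and a maximum over an empty range being read as $1$ (that is, $\iota_4=0$ or $\iota_5=0$). Then for every integer $l\le L$ such that $\alpha=l/L$ satisfies $\alpha_0\le\alpha\le1$ and $\alpha R\le C_\alpha$, and for every $\beta\in\mathcal B$, $$\mathbb{P}_\beta[E_l]\le\min_{t_\alpha\in[0,C_\alpha-\alpha R]}\Bigl(\binom{L}{\alpha L}\exp\{-n(D_1(\Delta_\alpha,1-\rho_1^2)-\iota_1)\}+\exp\{-n(D(t_\alpha,1-\rho_2^2)-\iota_2)\}\Bigr),$$ where $\Delta_\alpha=C_\alpha-\alpha R-t_\alpha$, $1-\rho_1^2=\alpha(1-\alpha)v/(1+\alpha v)$ and $1-\rho_2^2=\alpha^2v/(1+\alpha^2v)$.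 Moreover $\iota_1=O(1/\sqrt{dL})$ and $\iota_2=O(1/(dL))$: for fixed $v>0$ and $\alpha_0\in(0,1]$ there is a constant $K_1$ with $|\iota_1|\le K_1/\sqrt{dL}$ for all $d\ge1$, $L\ge2$, and there is an absolute constant $K_2$ with $|\iota_2|\le K_2/(dL)$ for all $d\ge1$, $L\ge2$. -/

import Mathlib

/-! Sparse superposition codes with a binomial dictionary over the AWGN channel. -/

namespace SuperpositionCode

open MeasureTheory ProbabilityTheory
open scoped ENNReal

noncomputable section

/-! ### Code, channel and decoder -/

/-- The column indices: `L` sections of size `M` (so `N = L * M` columns). -/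
abbrev Col (L M : ℕ) : Type := Fin L × Fin M

/-- The set `ℬ` of vectors in `{0,1}^N` with exactly one entry `1` in each section. -/
def messages (L M : ℕ) : Set (Col L M → ℝ) :=
  {β | (∀ j, β j = 0 ∨ β j = 1) ∧ ∀ s : Fin L, ∃! m : Fin M, β (s, m) = 1}

/-- The squared Euclidean norm on `ℝⁿ`. -/
def sqNorm {n : ℕ} (x : Fin n → ℝ) : ℝ := ∑ i, x i ^ 2

/-- `dec` is a maximum likelihood decoder: for each dictionary `X` and channel output `Y`, its value
is a minimizer of `‖Y - X β‖²` over `ℬ`. Nothing is assumed on how ties are broken. -/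
def IsMLDecoder {n L M : ℕ}
    (dec : Matrix (Fin n) (Col L M) ℝ → (Fin n → ℝ) → (Col L M → ℝ)) : Prop :=
  ∀ (X : Matrix (Fin n) (Col L M) ℝ) (Y : Fin n → ℝ),
    (messages L M).Nonempty → dec X Y ∈ messages L M ∧
      ∀ β ∈ messages L M, sqNorm (Y - X.mulVec (dec X Y)) ≤ sqNorm (Y - X.mulVec β)

open Classical in
/-- The number of sections in which `β'` differs from `β`. -/
def mistakes {L M : ℕ} (β' β : Col L M → ℝ) : ℕ :=
  (Finset.univ.filter fun s : Fin L => ∃ m : Fin M, β' (s, m) ≠ β (s, m)).card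

/-- The law of a random sign times `a`: the values `a` and `-a` have probability `1/2` each. -/
def signLaw (a : ℝ) : Measure ℝ :=
  (2⁻¹ : ℝ≥0∞) • Measure.dirac a + (2⁻¹ : ℝ≥0∞) • Measure.dirac (-a)

/-- The sample space: the `n × dN` matrix of random signs (the columns that belong to the column `j`
of the dictionary are indexed by `(j, k)` with `k : Fin d`), and the noise vector. -/
abbrev Sample (n L M d : ℕ) : Type := (Fin n → Col L M × Fin d → ℝ) × (Fin n → ℝ)

/-- The joint law: all entries of the sign matrix take the values `±√(P/(dL))` with probability
`1/2` each, the noise coordinates are `N(0, σ²)`, and all of these variables are independent. -/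
def jointLaw (n L M d : ℕ) (P σ : ℝ) : Measure (Sample n L M d) :=
  (Measure.pi fun _ : Fin n => Measure.pi fun _ : Col L M × Fin d =>
      signLaw (Real.sqrt (P / (d * L)))).prod
    (Measure.pi fun _ : Fin n => gaussianReal 0 (Real.toNNReal (σ ^ 2)))

/-- The binomial dictionary: each entry is the sum of the `d` signs that belong to it. -/
def dictionary {n L M d : ℕ} (ω : Sample n L M d) : Matrix (Fin n) (Col L M) ℝ :=
  Matrix.of fun i j => ∑ k : Fin d, ω.1 i (j, k)

/-- The channel output `Y = X β + ε`. -/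
def output {n L M d : ℕ} (β : Col L M → ℝ) (ω : Sample n L M d) : Fin n → ℝ :=
  (dictionary ω).mulVec β + ω.2

/-- The event `E_l` that decoding makes exactly `l` section mistakes when `β` is sent. -/
def mistakeEvent {n L M : ℕ} (d : ℕ)
    (dec : Matrix (Fin n) (Col L M) ℝ → (Fin n → ℝ) → (Col L M → ℝ))
    (β : Col L M → ℝ) (l : ℕ) : Set (Sample n L M d) :=
  {ω | mistakes (dec (dictionary ω) (output β ω)) β = l}

/-- The transmission rate in nats: `M ^ L` messages in `n` channel uses. -/
def rate (n L M : ℕ) : ℝ := L * Real.log M / n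

/-! ### Exponents -/

/-- `C_α = (1/2) ln (1 + α v)`. -/
def partialCapacity (v α : ℝ) : ℝ := 1 / 2 * Real.log (1 + α * v)

/-- `D(Δ, q)`, the maximum of `x Δ + (1/2) ln (1 - x² q)` over `x ≥ 0`; the `x` for which the argument
of the logarithm is not positive (value `-∞`) are left out. -/
def expD (Δ q : ℝ) : ℝ :=
  sSup ((fun x : ℝ => x * Δ + 1 / 2 * Real.log (1 - x ^ 2 * q)) ''
    {x : ℝ | 0 ≤ x ∧ 0 < 1 - x ^ 2 * q})

/-- `D₁(Δ, q)`, the same maximum over `0 ≤ x ≤ 1`. -/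
def expD₁ (Δ q : ℝ) : ℝ :=
  sSup ((fun x : ℝ => x * Δ + 1 / 2 * Real.log (1 - x ^ 2 * q)) ''
    {x : ℝ | (0 ≤ x ∧ x ≤ 1) ∧ 0 < 1 - x ^ 2 * q})

/-! ### Correction terms -/

/-- `c_ζ = 1/(1+2ζ)² + 1/(1-2ζ)²`. -/
def cZeta (ζ : ℝ) : ℝ := 1 / (1 + 2 * ζ) ^ 2 + 1 / (1 - 2 * ζ) ^ 2

/-- `φ_ζ(k)`. -/
def phiZeta (ζ : ℝ) (k : ℕ) : ℝ :=
  max (max ((3 / 16 * cZeta ζ ^ 2 + 1 / 12) * (1 / k))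
      (-(4 * ζ ^ 4 / 3) * k + Real.log (k / 2) + 1 / (12 * k)))
    (-(Real.log 2 - 1 / 2) * k + 1 / 2 * Real.log (Real.pi * k / 2))

/-- `φ(k)`, the infimum of `φ_ζ(k)` over `0 < ζ < 1/2`. -/
def phi (k : ℕ) : ℝ := sInf ((fun ζ : ℝ => phiZeta ζ k) '' Set.Ioo 0 (1 / 2))

/-- `η = √(9/(8πe))`. -/
def eta : ℝ := Real.sqrt (9 / (8 * Real.pi * Real.exp 1))

open Classical in
/-- The maximum of `f` over the `k ∈ {0, …, L}` with `p k`, or `1` if there is no such `k`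
(it is applied to functions with values at least `1`). -/
def maxOver (L : ℕ) (p : ℕ → Prop) (f : ℕ → ℝ) : ℝ :=
  if h : ((Finset.range (L + 1)).filter p).Nonempty then
    ((Finset.range (L + 1)).filter p).sup' h f
  else 1

/-- `ι₃`. -/
def iota₃ (L d : ℕ) (v α₀ : ℝ) : ℝ :=
  maxOver L (fun k => α₀ * L ≤ k)
    (fun k => Real.exp (phi (d * k)) * (1 + eta * (1 + v) / (d * k))) - 1

/-- `ι₄`. -/
def iota₄ (L d : ℕ) (α₀ : ℝ) : ℝ :=
  maxOver L (fun k => α₀ * L ≤ k ∧ (k : ℝ) ≤ L - Real.sqrt (L / d))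
    (fun k => Real.exp (phi (d * k) + phi (d * (L - k))) * (1 + eta / (d * k)) *
      (1 + eta / (d * ((L : ℝ) - k)))) - 1

/-- `ι₅`. -/
def iota₅ (L d : ℕ) : ℝ :=
  maxOver L (fun k => (L : ℝ) - Real.sqrt (L / d) ≤ k ∧ (k : ℝ) ≤ L - 1)
    (fun k => Real.exp (phi (d * k)) / Real.sqrt (1 - 1 / Real.sqrt (d * L)) *
      (1 + eta / (d * k))) - 1

/-- `ι₁`. -/
def iota₁ (L d : ℕ) (v α₀ : ℝ) : ℝ :=
  Real.log ((1 + iota₃ L d v α₀) * (1 + max (iota₄ L d α₀) (iota₅ L d)))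

/-- `ι₂`. -/
def iota₂ (L d : ℕ) : ℝ := phi (d * L) + Real.log (1 + 2 * eta / (d * L))

/-- `err_Bin(α)` for the parameter `t`, with `Δ_α = C_α - α R - t`. -/
def errBin (n L d l : ℕ) (v α₀ R α t : ℝ) : ℝ :=
  (L.choose l : ℝ) *
      Real.exp (-(n * (expD₁ (partialCapacity v α - α * R - t)
        (α * (1 - α) * v / (1 + α * v)) - iota₁ L d v α₀))) +
    Real.exp (-(n * (expD t (α ^ 2 * v / (1 + α ^ 2 * v)) - iota₂ L d)))

end

end SuperpositionCode

namespace SuperpositionCode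

open MeasureTheory ProbabilityTheory Filter Topology
open scoped ENNReal NNReal

noncomputable section

/-! ### Local comparison of the binomial law with the normal density -/

/-! Fix the set D of l wrong sections and split the codeword sum in a row as x (sent columns in D),
y (common columns) and z (rival columns in D); e is the noise, s = σ². The reference statistic is (e
+ α(x + y))²/(2(s + α²P)). If the decoder prefers a rival, then for any threshold t either the sent
word's own statistic is at least nt, or the statistic of some rival, with e replaced by e + x - z,
is at most nt (`mistakeEvent_subset`).

The first event is bounded by Chernoff's method, optimized over λ; this gives D. For the second,
Gallager's λ-th power with 0 ≤ λ ≤ 1 is applied to the sum over the at most M^l rivals for each D.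
Averaging over the independent z gives (1 + αv)^(-1/2) = e^(-C_α) per row, up to a correction, while
M^l = e^(nαR). What remains is an exponential moment of a quadratic form in x, y, e, and this gives
D₁ (`jointLaw_decoding_le`). Only the union over D is left outside the λ-th power, hence the
binomial coefficient.

All these moments would be explicit if x, y, z were Gaussian, so the work lies in replacing the law
of m random signs by a normal law inside integrals of exp(Ax² + Bx). If A ≥ 0, subgaussianity makes
the replacement free (`lintegral_binLaw_le_of_nonneg`). In general, Stirling's formula bounds each
atom by e^(φ(m)) times the Gaussian density (`choose_div_two_pow_le`), and Poisson summation bounds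
the remaining Gaussian Riemann sum by its integral times a dual theta sum 1 + O(1/m)
(`lintegral_binLaw_le_of_tsum_le`). Averaging over z produces ι₃, the x-replacement in the remaining
moment is absorbed by ι₄ and ι₅, and the sent word's statistic produces ι₂. Since φ(m) = O(1/m), the
stated orders follow. -/

/-- The logarithm of the Stirling sequence decreases by at most 1/(12k) - 1/(12(k+1)) at each step,
so subtracting 1/(12k) makes it increasing, with limit log √π. -/
theorem log_factorial_le {n : ℕ} (hn : n ≠ 0) :
    Real.log n.factorial ≤
      n * Real.log n - n + Real.log n / 2 + Real.log (2 * Real.pi) / 2 + 1 / (12 * n) := by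
  obtain ⟨m, rfl⟩ := Nat.exists_eq_succ_of_ne_zero hn
  have hmono : Monotone fun k : ℕ =>
      Real.log (Stirling.stirlingSeq (k + 1)) - 1 / (12 * ((k : ℝ) + 1)) := by
    refine monotone_nat_of_le_succ fun k => ?_
    have h := Stirling.log_stirlingSeq_sdiff_le (k + 1)
    have e : (1 : ℝ) / (12 * (k + 1) * (k + 1 + 1))
        = 1 / (12 * ((k : ℝ) + 1)) - 1 / (12 * ((k : ℝ) + 1 + 1)) := by
      field_simp; ring
    push_cast at h ⊢
    rw [e] at h
    linarith
  have hlim : Tendsto (fun k : ℕ =>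
      Real.log (Stirling.stirlingSeq (k + 1)) - 1 / (12 * ((k : ℝ) + 1))) atTop
      (𝓝 (Real.log (Real.sqrt Real.pi) - 0)) := by
    refine Tendsto.sub ?_ ?_
    · have h1 : Tendsto (fun k : ℕ => Stirling.stirlingSeq (k + 1)) atTop
          (𝓝 (Real.sqrt Real.pi)) :=
        Stirling.tendsto_stirlingSeq_sqrt_pi.comp (tendsto_add_atTop_nat 1)
      exact h1.log (by positivity)
    · have h2 := (tendsto_one_div_add_atTop_nhds_zero_nat (𝕜 := ℝ)).const_mul (1 / 12)
      simp only [mul_zero] at h2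
      refine h2.congr fun k => ?_
      field_simp
  have h := hmono.ge_of_tendsto hlim m
  have hf := Stirling.log_stirlingSeq_formula (m + 1)
  have hm : (0 : ℝ) < (m : ℝ) + 1 := by positivity
  push_cast at h hf ⊢
  rw [Real.log_div hm.ne' (Real.exp_pos 1).ne', Real.log_exp,
    Real.log_mul two_ne_zero hm.ne'] at hf
  rw [Real.log_sqrt Real.pi_pos.le] at h
  rw [Real.log_mul two_ne_zero Real.pi_pos.ne']
  simp only [Nat.succ_eq_add_one] at *
  linarith

theorem sq_add_pow_four_le_entropy {y : ℝ} (hy : |y| < 1) :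
    y ^ 2 + y ^ 4 / 6 ≤ (1 + y) * Real.log (1 + y) + (1 - y) * Real.log (1 - y) := by
  suffices H : ∀ y : ℝ, 0 ≤ y → y < 1 →
      y ^ 2 + y ^ 4 / 6 ≤ (1 + y) * Real.log (1 + y) + (1 - y) * Real.log (1 - y) by
    obtain ⟨h1, h2⟩ := abs_lt.1 hy
    rcases le_total 0 y with h | h
    · exact H y h h2
    · have := H (-y) (by linarith) (by linarith)
      simp only [sub_neg_eq_add, even_two.neg_pow, (by decide : Even 4).neg_pow,
        ← sub_eq_add_neg] at this
      linarith
  intro y h0 h1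
  have hd : ∀ t ∈ Set.Ioo (-1 : ℝ) 1, HasDerivAt (fun t : ℝ =>
      (1 + t) * Real.log (1 + t) + (1 - t) * Real.log (1 - t) - (t ^ 2 + t ^ 4 / 6))
      (Real.log (1 + t) - Real.log (1 - t) - (2 * t + 2 * t ^ 3 / 3)) t := by
    intro t ht
    have ha : (1 + t) ≠ 0 := by linarith [ht.1]
    have hb : (1 - t) ≠ 0 := by linarith [ht.2]
    have d1 : HasDerivAt (fun t : ℝ => 1 + t) 1 t := (hasDerivAt_id t).const_add 1
    have d2 : HasDerivAt (fun t : ℝ => 1 - t) (-1) t := (hasDerivAt_id t).const_sub 1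
    have := ((d1.mul (d1.log ha)).add (d2.mul (d2.log hb))).sub
      ((hasDerivAt_pow 2 t).add ((hasDerivAt_pow 4 t).div_const 6))
    refine this.congr_deriv ?_
    field_simp
    norm_num
    ring
  have hmono : MonotoneOn (fun t : ℝ =>
      (1 + t) * Real.log (1 + t) + (1 - t) * Real.log (1 - t) - (t ^ 2 + t ^ 4 / 6))
      (Set.Ico 0 1) := by
    refine monotoneOn_of_deriv_nonneg (convex_Ico 0 1) ?_ ?_ ?_
    · intro t ht
      exact (hd t ⟨by linarith [ht.1], ht.2⟩).continuousAt.continuousWithinAt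
    · intro t ht
      rw [interior_Ico] at ht
      exact (hd t ⟨by linarith [ht.1], ht.2⟩).differentiableAt.differentiableWithinAt
    · intro t ht
      rw [interior_Ico] at ht
      rw [(hd t ⟨by linarith [ht.1], ht.2⟩).deriv]
      -- The derivative is log((1+t)/(1-t)) minus the first two terms 2(t + t³/3) of its power
      -- series, and all the terms are nonnegative.
      have h := Real.sum_range_le_log_div ht.1.le ht.2 2
      rw [Real.log_div (by linarith [ht.1]) (by linarith [ht.2])] at h
      norm_num [Finset.sum_range_succ] at h
      linarith
  have := hmono ⟨le_refl 0, one_pos⟩ ⟨h0, h1⟩ h0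
  norm_num at this
  linarith

/-- This is 1/a² + 1/b² ≥ 2/(ab) for a = 1 + 2ζ, b = 1 - 2ζ. -/
theorem two_div_one_sub_le_cZeta {ζ : ℝ} (h0 : 0 < ζ) (h1 : ζ < 1 / 2) :
    2 / (1 - 4 * ζ ^ 2) ≤ cZeta ζ := by
  have hp : 0 < 1 + 2 * ζ := by linarith
  have hm : 0 < 1 - 2 * ζ := by linarith
  have e : (1 - 4 * ζ ^ 2) = (1 + 2 * ζ) * (1 - 2 * ζ) := by ring
  rw [cZeta, e, div_add_div _ _ (by positivity) (by positivity),
    div_le_div_iff₀ (by positivity) (by positivity)]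
  have : 0 < (1 + 2 * ζ) * (1 - 2 * ζ) := by positivity
  nlinarith [mul_nonneg this.le (mul_nonneg this.le (sq_nonneg ζ)), sq_nonneg ζ,
    mul_pos this this]

theorem neg_log_le_cZeta_mul {ζ x : ℝ} (h0 : 0 < ζ) (h1 : ζ < 1 / 2) (hx : |x| ≤ ζ) :
    -(1 / 2 * Real.log (1 - 4 * x ^ 2)) ≤ cZeta ζ * x ^ 2 := by
  have hx2 : x ^ 2 ≤ ζ ^ 2 := sq_le_sq' (by linarith [(abs_le.1 hx).1]) (abs_le.1 hx).2
  have hζ : 0 < 1 - 4 * ζ ^ 2 := by nlinarith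
  have hpos : 0 < 1 - 4 * x ^ 2 := by linarith
  have h := Real.one_sub_inv_le_log_of_pos hpos
  have hc := two_div_one_sub_le_cZeta h0 h1
  have h3 : 2 / (1 - 4 * x ^ 2) ≤ cZeta ζ :=
    le_trans (div_le_div_of_nonneg_left (by norm_num) hζ (by linarith)) hc
  have h4 : 2 / (1 - 4 * x ^ 2) * x ^ 2 ≤ cZeta ζ * x ^ 2 :=
    mul_le_mul_of_nonneg_right h3 (sq_nonneg x)
  have e : 2 / (1 - 4 * x ^ 2) * x ^ 2 = 1 / 2 * ((1 - 4 * x ^ 2)⁻¹ - 1) := by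
    field_simp; ring
  linarith

theorem phiZeta_nonneg {ζ : ℝ} (k : ℕ) : 0 ≤ phiZeta ζ k := by
  refine le_trans ?_ (le_trans (le_max_left _ _) (le_max_left _ _))
  positivity

theorem phi_nonneg (k : ℕ) : 0 ≤ phi k := by
  refine Real.sInf_nonneg ?_
  rintro _ ⟨ζ, -, rfl⟩
  exact phiZeta_nonneg k

theorem phi_le {ζ : ℝ} (h0 : 0 < ζ) (h1 : ζ < 1 / 2) (k : ℕ) : phi k ≤ phiZeta ζ k := by
  refine csInf_le ⟨0, ?_⟩ ⟨ζ, ⟨h0, h1⟩, rfl⟩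
  rintro _ ⟨ζ, -, rfl⟩
  exact phiZeta_nonneg k

/-- Stirling from above for m!, from below for j! and k!. The main terms form the binary entropy at
(1 ± y)/2, whose quadratic part is the Gaussian exponent; the quartic part is kept because it must
absorb the prefactor √(m²/(4jk)). -/
theorem log_choose_le_of_pos {m j k : ℕ} (hj : j ≠ 0) (hk : k ≠ 0) (hm : j + k = m) {y : ℝ}
    (hy : (m : ℝ) * y = (j : ℝ) - k) :
    Real.log (m.choose j) - m * Real.log 2 ≤
      1 / 2 * Real.log (2 / (Real.pi * m)) - m * y ^ 2 / 2 - m * y ^ 4 / 12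
        + (Real.log m - Real.log 2 - (Real.log j + Real.log k) / 2) + 1 / (12 * m) := by
  have hm0 : m ≠ 0 := by omega
  have hmp : (0 : ℝ) < m := by positivity
  have hjp : (0 : ℝ) < j := by positivity
  have hkp : (0 : ℝ) < k := by positivity
  have hmr : (m : ℝ) = j + k := by rw [← hm]; push_cast; ring
  have hy1 : 1 + y = 2 * j / m := by
    rw [eq_div_iff hmp.ne']; linarith
  have hy2 : 1 - y = 2 * k / m := by
    rw [eq_div_iff hmp.ne']; linarith
  have hya : |y| < 1 := by
    have p1 : 0 < 1 + y := by rw [hy1]; positivity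
    have p2 : 0 < 1 - y := by rw [hy2]; positivity
    rw [abs_lt]; constructor <;> linarith
  have hE := sq_add_pow_four_le_entropy hya
  rw [hy1, hy2, Real.log_div (by positivity) hmp.ne', Real.log_div (by positivity) hmp.ne',
    Real.log_mul two_ne_zero hjp.ne', Real.log_mul two_ne_zero hkp.ne'] at hE
  have hE' := mul_le_mul_of_nonneg_left hE hmp.le
  have e1 : (m : ℝ) * (2 * j / m * (Real.log 2 + Real.log j - Real.log m)
      + 2 * k / m * (Real.log 2 + Real.log k - Real.log m))
      = 2 * (m * Real.log 2 + j * Real.log j + k * Real.log k - m * Real.log m) := by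
    field_simp
    rw [hmr]; ring
  rw [e1] at hE'
  have hc : (m.choose j : ℝ) * j.factorial * k.factorial = m.factorial := by
    have := Nat.choose_mul_factorial_mul_factorial (n := m) (k := j) (by omega)
    rw [show m - j = k by omega] at this
    exact_mod_cast this
  have hcp : (0 : ℝ) < m.choose j := by
    exact_mod_cast Nat.choose_pos (by omega)
  have hlog : Real.log (m.choose j) + Real.log j.factorial + Real.log k.factorial
      = Real.log m.factorial := by
    rw [← hc, Real.log_mul (by positivity) (by positivity),
      Real.log_mul (by positivity) (by positivity)]
  have u := log_factorial_le hm0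
  have l1 := Stirling.le_log_factorial_stirling hj
  have l2 := Stirling.le_log_factorial_stirling hk
  rw [Real.log_div two_ne_zero (by positivity), Real.log_mul Real.pi_pos.ne' hmp.ne']
  rw [Real.log_mul two_ne_zero Real.pi_pos.ne'] at u l1 l2
  linarith

/-- The three entries of `phiZeta` are three regimes of x = j/m - 1/2. At j = 0 or m the coefficient
is 1, which gives the third. For |x| ≤ ζ the prefactor costs at most c_ζ x², and c_ζ x² - (4/3)m x⁴
≤ 3c_ζ²/(16m). For |x| > ζ the quartic gain is at least (4/3)ζ⁴m, and the prefactor costs at most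
log(m/2). -/
theorem log_choose_le {ζ : ℝ} (h0 : 0 < ζ) (h1 : ζ < 1 / 2) {m j : ℕ} (hm : m ≠ 0)
    (hj : j ≤ m) :
    Real.log (m.choose j) - m * Real.log 2 ≤
      phiZeta ζ m + 1 / 2 * Real.log (2 / (Real.pi * m)) - 2 * ((j : ℝ) - m / 2) ^ 2 / m := by
  have hmp : (0 : ℝ) < m := by positivity
  by_cases hb : j = 0 ∨ j = m
  · have hc : (m.choose j : ℝ) = 1 := by rcases hb with rfl | rfl <;> simp
    have hs : 2 * ((j : ℝ) - m / 2) ^ 2 / m = m / 2 := by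
      rcases hb with rfl | rfl <;> field_simp <;> push_cast <;> ring
    have h3 : -(Real.log 2 - 1 / 2) * m + 1 / 2 * Real.log (Real.pi * m / 2) ≤ phiZeta ζ m :=
      le_max_right _ _
    have e : Real.log (2 / (Real.pi * m)) = -Real.log (Real.pi * m / 2) := by
      rw [← Real.log_inv, inv_div]
    rw [hc, hs, Real.log_one, e]
    linarith
  · push Not at hb
    obtain ⟨k, rfl⟩ := Nat.exists_eq_add_of_le hj
    have hk : k ≠ 0 := by rintro rfl; exact hb.2 rfl
    set m := j + k with hmdef
    set x : ℝ := ((j : ℝ) - k) / (2 * m) with hx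
    have hjp : (0 : ℝ) < j := by have := hb.1; positivity
    have hkp : (0 : ℝ) < k := by positivity
    have hmr : (m : ℝ) = j + k := by rw [hmdef]; push_cast; ring
    have hy : (m : ℝ) * (2 * x) = (j : ℝ) - k := by rw [hx]; field_simp
    have H := log_choose_le_of_pos hb.1 hk rfl hy
    have e1 : 2 * ((j : ℝ) - m / 2) ^ 2 / m = m * (2 * x) ^ 2 / 2 := by
      rw [hx, hmr]; field_simp; ring
    rw [e1]
    suffices hs : -(m * (2 * x) ^ 4 / 12)
        + (Real.log m - Real.log 2 - (Real.log j + Real.log k) / 2) + 1 / (12 * m)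
        ≤ phiZeta ζ m by linarith
    rcases le_or_gt |x| ζ with hxz | hxz
    · refine le_trans ?_ (le_trans (le_max_left _ _) (le_max_left _ _))
      have h := neg_log_le_cZeta_mul h0 h1 hxz
      have e2 : 1 - 4 * x ^ 2 = 4 * (j * k) / (m * m) := by
        rw [hx, hmr]; field_simp; ring
      rw [e2, Real.log_div (by positivity) (by positivity), Real.log_mul (by norm_num)
        (by positivity), Real.log_mul hjp.ne' hkp.ne', Real.log_mul hmp.ne' hmp.ne',
        show (4 : ℝ) = 2 ^ 2 by norm_num, Real.log_pow] at h
      have hq : cZeta ζ * x ^ 2 - m * (2 * x) ^ 4 / 12 ≤ 3 / 16 * cZeta ζ ^ 2 * (1 / m) := by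
        have := sq_nonneg (8 * m * x ^ 2 - 3 * cZeta ζ)
        rw [mul_one_div, le_div_iff₀ hmp]
        nlinarith
      have e3 : (3 / 16 * cZeta ζ ^ 2 + 1 / 12) * (1 / (m : ℝ))
        = 3 / 16 * cZeta ζ ^ 2 * (1 / m) + 1 / (12 * m) := by field_simp
      rw [e3]
      push_cast at h
      linarith
    · refine le_trans ?_ (le_trans (le_max_right _ _) (le_max_left _ _))
      have lj : 0 ≤ Real.log j := Real.log_natCast_nonneg j
      have lk : 0 ≤ Real.log k := Real.log_natCast_nonneg k
      have hx4 : ζ ^ 4 ≤ x ^ 4 := by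
        have := pow_le_pow_left₀ h0.le hxz.le 4
        rwa [(by decide : Even 4).pow_abs] at this
      have := mul_le_mul_of_nonneg_left hx4 hmp.le
      rw [Real.log_div hmp.ne' two_ne_zero]
      nlinarith

theorem choose_div_two_pow_le {m : ℕ} (hm : m ≠ 0) (j : ℕ) :
    (m.choose j : ℝ) / 2 ^ m ≤ Real.exp (phi m) *
      (Real.sqrt (2 / (Real.pi * m)) * Real.exp (-(2 * ((j : ℝ) - m / 2) ^ 2 / m))) := by
  rcases lt_or_ge m j with h | hj
  · rw [Nat.choose_eq_zero_of_lt h]; simp; positivity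
  have hmp : (0 : ℝ) < m := by positivity
  have hcp : (0 : ℝ) < m.choose j := by exact_mod_cast Nat.choose_pos hj
  have hs : 0 < 2 / (Real.pi * m) := by positivity
  have hphi : Real.log (m.choose j) - m * Real.log 2 - 1 / 2 * Real.log (2 / (Real.pi * m))
      + 2 * ((j : ℝ) - m / 2) ^ 2 / m ≤ phi m := by
    refine le_csInf ⟨_, ⟨1 / 4, by norm_num, rfl⟩⟩ ?_
    rintro _ ⟨ζ, hζ, rfl⟩
    have := log_choose_le hζ.1 hζ.2 hm hj
    simp only
    linarith
  rw [← Real.log_le_log_iff (by positivity) (by positivity), Real.log_mul (by positivity)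
    (by positivity), Real.log_mul (by positivity) (by positivity), Real.log_exp, Real.log_exp,
    Real.log_sqrt hs.le, Real.log_div hcp.ne' (by positivity), Real.log_pow]
  linarith

/-! ### Lattice sums of Gaussian functions -/

/-- Reduces summability over a shifted lattice to that of the two-variable theta series. -/
theorem exp_neg_eq_norm_jacobiTheta₂_term (t c : ℝ) (n : ℤ) :
    Real.exp (-Real.pi * t * (n + c) ^ 2) = Real.exp (-Real.pi * t * c ^ 2) *
      ‖jacobiTheta₂_term n (Complex.I * (t * c)) (Complex.I * t)‖ := by
  rw [jacobiTheta₂_term, Complex.norm_exp, ← Real.exp_add]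
  congr 1
  have : (2 * Real.pi * Complex.I * n * (Complex.I * (t * c))
      + Real.pi * Complex.I * n ^ 2 * (Complex.I * t) : ℂ)
      = ((-(2 * Real.pi * n * (t * c)) - Real.pi * n ^ 2 * t : ℝ) : ℂ) := by
    push_cast
    linear_combination (2 * Real.pi * n * (t * c) + Real.pi * n ^ 2 * t) * Complex.I_sq
  rw [this, Complex.ofReal_re]
  ring

theorem summable_exp_neg_int_add_sq {t : ℝ} (ht : 0 < t) (c : ℝ) :
    Summable fun n : ℤ => Real.exp (-Real.pi * t * (n + c) ^ 2) := by
  simp_rw [exp_neg_eq_norm_jacobiTheta₂_term]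
  refine Summable.mul_left _ (Summable.norm ?_)
  exact (summable_jacobiTheta₂_term_iff _ _).2 (by simpa using ht)

theorem summable_exp_neg_int_sq {t : ℝ} (ht : 0 < t) :
    Summable fun n : ℤ => Real.exp (-Real.pi * t * (n : ℝ) ^ 2) := by
  simpa using summable_exp_neg_int_add_sq ht 0

/-- Poisson summation: shifting the lattice can only decrease the dual sum. -/
theorem tsum_exp_neg_int_add_sq_le {t : ℝ} (ht : 0 < t) (c : ℝ) :
    ∑' n : ℤ, Real.exp (-Real.pi * t * (n + c) ^ 2) ≤
      1 / Real.sqrt t * ∑' n : ℤ, Real.exp (-Real.pi * t⁻¹ * (n : ℝ) ^ 2) := by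
  have hP := Complex.tsum_exp_neg_quadratic (a := (t : ℂ)) (by simpa using ht) (-(t * c : ℝ))
  have hL : ((∑' n : ℤ, Real.exp (-Real.pi * t * (n + c) ^ 2) : ℝ) : ℂ)
      = (Real.exp (-Real.pi * t * c ^ 2) : ℂ) *
        ∑' n : ℤ, Complex.exp (-Real.pi * t * n ^ 2 + 2 * Real.pi * (-(t * c : ℝ)) * n) := by
    rw [Complex.ofReal_tsum, ← tsum_mul_left]
    refine tsum_congr fun n => ?_
    push_cast
    rw [← Complex.exp_add]
    congr 1
    ring
  -- On the dual side the shift c only contributes a phase and a factor independent of n; that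
  -- factor cancels against the prefactor in `hL`.
  have hn : ∀ n : ℤ, ‖Complex.exp (-Real.pi / t * (n + Complex.I * (-(t * c : ℝ))) ^ 2)‖
      = Real.exp (Real.pi * t * c ^ 2) * Real.exp (-Real.pi * t⁻¹ * (n : ℝ) ^ 2) := by
    intro n
    rw [Complex.norm_exp, ← Real.exp_add]
    congr 1
    have : (-Real.pi / t * (n + Complex.I * (-(t * c : ℝ))) ^ 2 : ℂ)
        = ((Real.pi * t * c ^ 2 + -Real.pi * t⁻¹ * (n : ℝ) ^ 2 : ℝ) : ℂ)
          + ((2 * Real.pi * n * c : ℝ) : ℂ) * Complex.I := by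
      have : (t : ℂ) ≠ 0 := by exact_mod_cast ht.ne'
      push_cast
      field_simp
      linear_combination (-(t : ℂ) ^ 2 * c ^ 2) * Complex.I_sq
    rw [this, Complex.add_re, Complex.ofReal_re, Complex.re_ofReal_mul, Complex.I_re, mul_zero,
      add_zero]
  have hs : Summable fun n : ℤ =>
      ‖Complex.exp (-Real.pi / t * (n + Complex.I * (-(t * c : ℝ))) ^ 2)‖ := by
    simp_rw [hn]
    exact (summable_exp_neg_int_sq (inv_pos.2 ht)).mul_left _
  have hnn : 0 ≤ ∑' n : ℤ, Real.exp (-Real.pi * t * (n + c) ^ 2) :=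
    tsum_nonneg fun n => (Real.exp_pos _).le
  rw [← abs_of_nonneg hnn, ← Real.norm_eq_abs, ← Complex.norm_real, hL, hP, norm_mul, norm_mul]
  have h1 : ‖(Real.exp (-Real.pi * t * c ^ 2) : ℂ)‖ = Real.exp (-Real.pi * t * c ^ 2) := by
    rw [Complex.norm_real, Real.norm_of_nonneg (Real.exp_pos _).le]
  have h2 : ‖1 / (t : ℂ) ^ (1 / 2 : ℂ)‖ = 1 / Real.sqrt t := by
    rw [norm_div, norm_one, Complex.norm_cpow_eq_rpow_re_of_pos ht, Real.sqrt_eq_rpow]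
    norm_num
  rw [h1, h2]
  have h3 := norm_tsum_le_tsum_norm hs
  simp_rw [hn] at h3
  rw [tsum_mul_left] at h3
  calc _ ≤ Real.exp (-Real.pi * t * c ^ 2) * (1 / Real.sqrt t * (Real.exp (Real.pi * t * c ^ 2)
        * ∑' n : ℤ, Real.exp (-Real.pi * t⁻¹ * (n : ℝ) ^ 2))) := by gcongr
    _ = (Real.exp (-Real.pi * t * c ^ 2) * Real.exp (Real.pi * t * c ^ 2)) *
        (1 / Real.sqrt t * ∑' n : ℤ, Real.exp (-Real.pi * t⁻¹ * (n : ℝ) ^ 2)) := by ring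
    _ = _ := by
      rw [← Real.exp_add, show -Real.pi * t * c ^ 2 + Real.pi * t * c ^ 2 = 0 by ring,
        Real.exp_zero, one_mul]

/-- For n ≠ 0 the hypothesis at x = bn² gives exp(-bn²) ≤ C/(bn²), and the sum of 1/n² over nonzero
integers is π²/3. -/
theorem tsum_exp_neg_int_sq_le {b C : ℝ} (hb : 0 < b)
    (hC : ∀ x, b ≤ x → x * Real.exp (-x) ≤ C) :
    ∑' n : ℤ, Real.exp (-b * (n : ℝ) ^ 2) ≤ 1 + C * Real.pi ^ 2 / (3 * b) := by
  have hz := hasSum_zeta_two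
  have hz' : HasSum (fun k : ℕ => (1 : ℝ) / ((k : ℝ) + 1) ^ 2) (Real.pi ^ 2 / 6) := by
    have := (hasSum_nat_add_iff (f := fun n : ℕ => (1 : ℝ) / (n : ℝ) ^ 2) 1
      (g := Real.pi ^ 2 / 6)).2 (by simpa using hz)
    simpa using this
  have hbd : ∀ k : ℕ, Real.exp (-b * ((k : ℝ) + 1) ^ 2) ≤ C / b * (1 / ((k : ℝ) + 1) ^ 2) := by
    intro k
    have hk : (1 : ℝ) ≤ ((k : ℝ) + 1) ^ 2 := one_le_pow₀ (by linarith [k.cast_nonneg (α := ℝ)])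
    have := hC (b * ((k : ℝ) + 1) ^ 2) (le_mul_of_one_le_right hb.le hk)
    rw [div_mul_div_comm, mul_one, le_div_iff₀ (by positivity)]
    rw [neg_mul]
    linarith
  have hsum : Summable fun k : ℕ => Real.exp (-b * ((k : ℝ) + 1) ^ 2) :=
    Summable.of_nonneg_of_le (fun k => (Real.exp_pos _).le) hbd (hz'.summable.mul_left _)
  have hle : ∑' k : ℕ, Real.exp (-b * ((k : ℝ) + 1) ^ 2) ≤ C / b * (Real.pi ^ 2 / 6) := by
    rw [← hz'.tsum_eq, ← tsum_mul_left]
    exact hsum.tsum_le_tsum hbd (hz'.summable.mul_left _)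
  have h1 : Summable fun k : ℕ => Real.exp (-b * (((k : ℤ) + 1 : ℤ) : ℝ) ^ 2) := by
    push_cast; exact hsum
  have h2 : Summable fun k : ℕ => Real.exp (-b * ((-((k : ℤ) + 1) : ℤ) : ℝ) ^ 2) := by
    push_cast; simp_rw [neg_sq]; exact hsum
  rw [tsum_of_add_one_of_neg_add_one (f := fun n : ℤ => Real.exp (-b * (n : ℝ) ^ 2)) h1 h2]
  push_cast
  simp_rw [neg_sq]
  have e : C * Real.pi ^ 2 / (3 * b) = 2 * (C / b * (Real.pi ^ 2 / 6)) := by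
    field_simp; ring
  rw [e]
  simp only [ne_eq, OfNat.ofNat_ne_zero, not_false_eq_true, zero_pow, mul_zero,
    Real.exp_zero]
  linarith

theorem eta_nonneg : 0 ≤ eta := Real.sqrt_nonneg _

theorem two_thirds_exp_neg_one_le_eta : 2 / 3 * Real.exp (-1) ≤ eta := by
  refine Real.le_sqrt_of_sq_le ?_
  have he : Real.exp (-1) = 1 / Real.exp 1 := by rw [Real.exp_neg, one_div]
  rw [he]
  have h1 := Real.exp_one_gt_d9
  have h2 := Real.pi_lt_d2
  have hp := Real.pi_pos
  have hpos : (0 : ℝ) < Real.exp 1 := Real.exp_pos 1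
  rw [show (2 / 3 * (1 / Real.exp 1)) ^ 2 = 4 / (9 * Real.exp 1 ^ 2) by field_simp; ring,
    div_le_div_iff₀ (by positivity) (by positivity)]
  nlinarith

theorem three_mul_exp_le_eta : 3 * Real.exp (-(9 / 4)) ≤ eta := by
  refine Real.le_sqrt_of_sq_le ?_
  have h1 := Real.exp_one_gt_d9
  have h2 := Real.pi_lt_d2
  have hp := Real.pi_pos
  -- After squaring, the claim is 8π ≤ e^(7/2), and 8π < 26.
  have h7 : (26 : ℝ) ≤ Real.exp (7 / 2) := by
    have e : Real.exp (7 / 2) = Real.exp 1 ^ 3 * Real.exp (1 / 2) := by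
      rw [← Real.exp_nat_mul, ← Real.exp_add]; norm_num
    have h3 : (2.7 : ℝ) ^ 3 ≤ Real.exp 1 ^ 3 := pow_le_pow_left₀ (by norm_num) (by linarith) 3
    have h4 : (1 / 2 : ℝ) + 1 ≤ Real.exp (1 / 2) := Real.add_one_le_exp _
    rw [e]
    nlinarith
  have e : Real.exp (-(9 / 4)) ^ 2 = 1 / (Real.exp 1 * Real.exp (7 / 2)) := by
    rw [← Real.exp_nat_mul, ← Real.exp_add, one_div, ← Real.exp_neg]; norm_num
  have hpos : (0 : ℝ) < Real.exp 1 := Real.exp_pos 1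
  rw [mul_pow, e, mul_one_div, div_le_div_iff₀ (by positivity) (by positivity)]
  nlinarith

/-- The relative error of the Riemann sum of a Gaussian with variance `m a² / r` and step `2 a`. -/
theorem tsum_dual_le_of_pos {m r : ℝ} (hm : 0 < m) (hr : 0 < r) :
    ∑' n : ℤ, Real.exp (-Real.pi * (2 * r / (Real.pi * m))⁻¹ * (n : ℝ) ^ 2) ≤
      1 + eta * r / m := by
  have hpi := Real.pi_pos
  have e : ∀ n : ℤ, -Real.pi * (2 * r / (Real.pi * m))⁻¹ * (n : ℝ) ^ 2
    = -(Real.pi ^ 2 * m / (2 * r)) * (n : ℝ) ^ 2 := by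
      intro n; field_simp
  simp_rw [e]
  refine (tsum_exp_neg_int_sq_le (by positivity)
    (fun x _ => Real.mul_exp_neg_le_exp_neg_one x)).trans ?_
  have e2 : Real.exp (-1) * Real.pi ^ 2 / (3 * (Real.pi ^ 2 * m / (2 * r)))
    = 2 / 3 * Real.exp (-1) * r / m := by field_simp
  rw [e2]
  have := two_thirds_exp_neg_one_le_eta
  gcongr

/-- For r ≤ 2 the factor r can be removed from the error: the decay rate is at least π²/4 > 9/4, and
beyond 9/4 the function x e^(-x) stays below its value there, which is smaller than the global
maximum 1/e. -/
theorem tsum_dual_le_of_le_two {m r : ℝ} (hm : 1 ≤ m) (hr : 0 < r) (hr2 : r ≤ 2) :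
    ∑' n : ℤ, Real.exp (-Real.pi * (2 * r / (Real.pi * m))⁻¹ * (n : ℝ) ^ 2) ≤
      1 + eta / m := by
  have hpi := Real.pi_gt_three
  have e : ∀ n : ℤ, -Real.pi * (2 * r / (Real.pi * m))⁻¹ * (n : ℝ) ^ 2
    = -(Real.pi ^ 2 * m / (2 * r)) * (n : ℝ) ^ 2 := by
      intro n; field_simp
  simp_rw [e]
  have hb : 9 / 4 ≤ Real.pi ^ 2 * m / (2 * r) := by
    rw [div_le_div_iff₀ (by norm_num) (by positivity)]
    nlinarith
  have hC : ∀ x, Real.pi ^ 2 * m / (2 * r) ≤ x →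
      x * Real.exp (-x) ≤ 9 / 4 * Real.exp (-(9 / 4)) := by
    intro x hx
    have h := Real.add_one_le_exp (x - 9 / 4)
    have hx' : x ≤ 9 / 4 * Real.exp (x - 9 / 4) := by linarith
    calc x * Real.exp (-x) ≤ 9 / 4 * Real.exp (x - 9 / 4) * Real.exp (-x) := by gcongr
      _ = 9 / 4 * Real.exp (-(9 / 4)) := by
        rw [mul_assoc, ← Real.exp_add]; ring_nf
  refine (tsum_exp_neg_int_sq_le (by positivity) hC).trans ?_
  have e2 : 9 / 4 * Real.exp (-(9 / 4)) * Real.pi ^ 2 / (3 * (Real.pi ^ 2 * m / (2 * r)))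
    = 3 / 2 * Real.exp (-(9 / 4)) * r / m := by field_simp; ring
  rw [e2]
  have := three_mul_exp_le_eta
  have hexp := Real.exp_pos (-(9 / 4))
  gcongr
  nlinarith

/-! ### Sums of random signs -/

instance isProbabilityMeasure_signLaw (a : ℝ) : IsProbabilityMeasure (signLaw a) := by
  constructor
  simp [signLaw, ENNReal.inv_two_add_inv_two]

theorem lintegral_signLaw (a : ℝ) (f : ℝ → ℝ≥0∞) :
    ∫⁻ x, f x ∂signLaw a = 2⁻¹ * f a + 2⁻¹ * f (-a) := by
  simp [signLaw, lintegral_add_measure, lintegral_smul_measure]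

/-- The law of the sum of `m` independent random signs times `a`. -/
def binLaw (a : ℝ) : ℕ → Measure ℝ
  | 0 => Measure.dirac 0
  | m + 1 => Measure.conv (signLaw a) (binLaw a m)

instance isProbabilityMeasure_binLaw (a : ℝ) (m : ℕ) : IsProbabilityMeasure (binLaw a m) := by
  induction m with
  | zero => unfold binLaw; infer_instance
  | succ m ih => unfold binLaw; infer_instance

theorem lintegral_binLaw_succ (a : ℝ) (m : ℕ) {f : ℝ → ℝ≥0∞} (hf : Measurable f) :
    ∫⁻ x, f x ∂binLaw a (m + 1) =
      2⁻¹ * ∫⁻ x, f (a + x) ∂binLaw a m + 2⁻¹ * ∫⁻ x, f (-a + x) ∂binLaw a m := by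
  rw [binLaw, Measure.lintegral_conv hf, lintegral_signLaw]

theorem lintegral_binLaw (a : ℝ) (m : ℕ) {f : ℝ → ℝ≥0∞} (hf : Measurable f) :
    ∫⁻ x, f x ∂binLaw a m =
      ∑ j ∈ Finset.range (m + 1), (m.choose j : ℝ≥0∞) * (2⁻¹ ^ m * f (a * (2 * j - m))) := by
  induction m generalizing f with
  | zero => simp [binLaw]
  | succ m ih =>
    rw [lintegral_binLaw_succ a m hf, ih (by fun_prop), ih (by fun_prop),
      Finset.sum_choose_succ_mul (fun i _ => (2⁻¹ ^ (m + 1) * f (a * (2 * i - (m + 1 : ℕ))))) m,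
      add_comm, Finset.mul_sum, Finset.mul_sum]
    congr 1 <;> refine Finset.sum_congr rfl fun j _ => ?_
    · rw [show -a + a * (2 * (j : ℝ) - m) = a * (2 * (j : ℝ) - (m + 1 : ℕ)) by push_cast; ring,
        pow_succ]
      ring
    · rw [show a + a * (2 * (j : ℝ) - m) = a * (2 * ((j + 1 : ℕ) : ℝ) - (m + 1 : ℕ)) by
        push_cast; ring, pow_succ]
      ring

/-- Each sign contributes cosh(ta) ≤ exp(t²a²/2), the moment of a normal variable of variance a². -/
theorem lintegral_exp_binLaw_le (a t : ℝ) (m : ℕ) :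
    ∫⁻ x, ENNReal.ofReal (Real.exp (t * x)) ∂binLaw a m ≤
      ENNReal.ofReal (Real.exp (t ^ 2 * (m * a ^ 2) / 2)) := by
  induction m with
  | zero => simp [binLaw]
  | succ m ih =>
    rw [lintegral_binLaw_succ a m (by fun_prop)]
    have e : ∀ c : ℝ, ∫⁻ x, ENNReal.ofReal (Real.exp (t * (c + x))) ∂binLaw a m
        = ENNReal.ofReal (Real.exp (t * c)) *
          ∫⁻ x, ENNReal.ofReal (Real.exp (t * x)) ∂binLaw a m := by
      intro c
      rw [← lintegral_const_mul _ (by fun_prop)]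
      refine lintegral_congr fun x => ?_
      rw [← ENNReal.ofReal_mul (Real.exp_pos _).le, ← Real.exp_add, mul_add]
    rw [e, e, ← mul_assoc, ← mul_assoc, ← add_mul]
    have h2 : (2⁻¹ : ℝ≥0∞) = ENNReal.ofReal (1 / 2) := by
      rw [one_div, ENNReal.ofReal_inv_of_pos two_pos]; simp
    have hc : 2⁻¹ * ENNReal.ofReal (Real.exp (t * a)) + 2⁻¹ * ENNReal.ofReal (Real.exp (t * -a))
        ≤ ENNReal.ofReal (Real.exp ((t * a) ^ 2 / 2)) := by
      rw [h2, ← ENNReal.ofReal_mul (by norm_num), ← ENNReal.ofReal_mul (by norm_num),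
        ← ENNReal.ofReal_add (by positivity) (by positivity)]
      refine ENNReal.ofReal_le_ofReal ?_
      have := Real.cosh_le_exp_half_sq (t * a)
      rw [Real.cosh_eq, ← mul_neg] at this
      linarith
    calc _ ≤ ENNReal.ofReal (Real.exp ((t * a) ^ 2 / 2)) *
          ENNReal.ofReal (Real.exp (t ^ 2 * (m * a ^ 2) / 2)) := by gcongr
      _ = _ := by
        rw [← ENNReal.ofReal_mul (Real.exp_pos _).le, ← Real.exp_add]
        congr 2
        push_cast
        ring

/-! ### Gaussian integrals of exponentials of quadratic polynomials -/

/-- The centered normal law of variance `V`. -/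
abbrev normalLaw (V : ℝ) : Measure ℝ := gaussianReal 0 V.toNNReal

theorem lintegral_normalLaw {V : ℝ} (hV : 0 < V) {f : ℝ → ℝ≥0∞} (hf : Measurable f) :
    ∫⁻ x, f x ∂normalLaw V = ∫⁻ x, ENNReal.ofReal
      (1 / Real.sqrt (2 * Real.pi * V) * Real.exp (-x ^ 2 / (2 * V))) * f x := by
  have hv : V.toNNReal ≠ 0 := by simpa using hV
  rw [normalLaw, gaussianReal_of_var_ne_zero _ hv,
    lintegral_withDensity_eq_lintegral_mul _ (measurable_gaussianPDF _ _) hf]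
  refine lintegral_congr fun x => ?_
  simp [gaussianPDF, gaussianPDFReal, Real.coe_toNNReal _ hV.le]

/-- Completing the square turns the integrand into a multiple of the normal density with mean BV/r
and variance V/r, where r = 1 - 2AV. -/
theorem lintegral_exp_quadratic_normalLaw {V : ℝ} (hV : 0 < V) {A B : ℝ}
    (hr : 0 < 1 - 2 * A * V) :
    ∫⁻ x, ENNReal.ofReal (Real.exp (A * x ^ 2 + B * x)) ∂normalLaw V =
      ENNReal.ofReal (1 / Real.sqrt (1 - 2 * A * V) *
        Real.exp (B ^ 2 * V / (2 * (1 - 2 * A * V)))) := by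
  set r := 1 - 2 * A * V with hrdef
  have hv : (V / r).toNNReal ≠ 0 := by simp; positivity
  have hA : A = (1 - r) / (2 * V) := by rw [hrdef]; field_simp; ring
  rw [lintegral_normalLaw hV (by fun_prop)]
  have h1 := lintegral_gaussianPDF_eq_one (B * V / r) hv
  rw [← mul_one (ENNReal.ofReal _), ← h1, ← lintegral_const_mul _ (measurable_gaussianPDF _ _)]
  refine lintegral_congr fun x => ?_
  rw [gaussianPDF, gaussianPDFReal, ← ENNReal.ofReal_mul (by positivity),
    ← ENNReal.ofReal_mul (by positivity), Real.coe_toNNReal _ (by positivity)]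
  congr 1
  have e1 : Real.sqrt (2 * Real.pi * (V / r)) = Real.sqrt (2 * Real.pi * V) / Real.sqrt r := by
    rw [← Real.sqrt_div (by positivity)]; congr 1; ring
  have e2 : Real.exp (B ^ 2 * V / (2 * r)) * Real.exp (-(x - B * V / r) ^ 2 / (2 * (V / r)))
      = Real.exp (-x ^ 2 / (2 * V)) * Real.exp (A * x ^ 2 + B * x) := by
    rw [← Real.exp_add, ← Real.exp_add, hA]
    congr 1
    field_simp
    ring
  have hsr : Real.sqrt r ≠ 0 := by positivity
  rw [e1]
  calc _ = 1 / Real.sqrt (2 * Real.pi * V) *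
        (Real.exp (-x ^ 2 / (2 * V)) * Real.exp (A * x ^ 2 + B * x)) := by ring
    _ = _ := by rw [← e2]; field_simp

theorem lintegral_exp_sq_normalLaw {V : ℝ} (hV : 0 < V) {κ u θ : ℝ}
    (hr : 0 < 1 - 2 * κ * θ ^ 2 * V) :
    ∫⁻ x, ENNReal.ofReal (Real.exp (κ * (u + θ * x) ^ 2)) ∂normalLaw V =
      ENNReal.ofReal (1 / Real.sqrt (1 - 2 * κ * θ ^ 2 * V) *
        Real.exp (κ / (1 - 2 * κ * θ ^ 2 * V) * u ^ 2)) := by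
  have hr' : 0 < 1 - 2 * (κ * θ ^ 2) * V := by linarith
  have h := lintegral_exp_quadratic_normalLaw hV (A := κ * θ ^ 2) (B := 2 * κ * u * θ) hr'
  have e : ∀ x, ENNReal.ofReal (Real.exp (κ * (u + θ * x) ^ 2)) =
      ENNReal.ofReal (Real.exp (κ * u ^ 2)) *
        ENNReal.ofReal (Real.exp (κ * θ ^ 2 * x ^ 2 + 2 * κ * u * θ * x)) := by
    intro x
    rw [← ENNReal.ofReal_mul (Real.exp_pos _).le, ← Real.exp_add]
    congr 2; ring
  simp_rw [e]
  rw [lintegral_const_mul _ (by fun_prop), h, ← ENNReal.ofReal_mul (Real.exp_pos _).le,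
    show 2 * (κ * θ ^ 2) * V = 2 * κ * θ ^ 2 * V by ring]
  congr 1
  rw [mul_left_comm, ← Real.exp_add]
  congr 2
  set r := 1 - 2 * κ * θ ^ 2 * V with hrd
  field_simp
  rw [hrd]
  ring

theorem lintegral_exp_normalLaw (V t : ℝ) (hV : 0 ≤ V) :
    ∫⁻ x, ENNReal.ofReal (Real.exp (t * x)) ∂normalLaw V =
      ENNReal.ofReal (Real.exp (t ^ 2 * V / 2)) := by
  rcases hV.eq_or_lt with rfl | hV
  · simp [normalLaw]
  · have := lintegral_exp_quadratic_normalLaw hV (A := 0) (B := t) (by simp)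
    simpa using this

/-! ### Comparison of the sum of random signs with the normal law -/

/-- Subgaussian comparison. -/
theorem lintegral_binLaw_le_of_nonneg (a : ℝ) (m : ℕ) {A : ℝ} (hA : 0 ≤ A) (B : ℝ) :
    ∫⁻ x, ENNReal.ofReal (Real.exp (A * x ^ 2 + B * x)) ∂binLaw a m ≤
      ∫⁻ x, ENNReal.ofReal (Real.exp (A * x ^ 2 + B * x)) ∂normalLaw (m * a ^ 2) := by
  -- Since A ≥ 0, exp(Ax²) is the average of exp(√(2A) w x) over a standard normal w. The exponent
  -- becomes linear in x, and moment generating functions can be compared for each w.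
  have e : ∀ x : ℝ, ENNReal.ofReal (Real.exp (A * x ^ 2 + B * x)) =
      ∫⁻ w, ENNReal.ofReal (Real.exp ((Real.sqrt (2 * A) * w + B) * x)) ∂normalLaw 1 := by
    intro x
    have h := lintegral_exp_normalLaw 1 (Real.sqrt (2 * A) * x) zero_le_one
    have e1 : ∀ w : ℝ, ENNReal.ofReal (Real.exp ((Real.sqrt (2 * A) * w + B) * x)) =
        ENNReal.ofReal (Real.exp (B * x)) *
          ENNReal.ofReal (Real.exp (Real.sqrt (2 * A) * x * w)) := by
      intro w
      rw [← ENNReal.ofReal_mul (Real.exp_pos _).le, ← Real.exp_add]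
      congr 2; ring
    simp_rw [e1]
    rw [lintegral_const_mul _ (by fun_prop), h, ← ENNReal.ofReal_mul (Real.exp_pos _).le,
      ← Real.exp_add, mul_pow, Real.sq_sqrt (by positivity)]
    congr 2; ring
  simp_rw [e]
  rw [lintegral_lintegral_swap (μ := binLaw a m) (by fun_prop),
    lintegral_lintegral_swap (μ := normalLaw (m * a ^ 2)) (by fun_prop)]
  refine lintegral_mono fun w => ?_
  rw [lintegral_exp_normalLaw _ _ (by positivity)]
  exact lintegral_exp_binLaw_le _ _ _

/-- The Gaussian bound on the atoms, multiplied by exp(Ax² + Bx), is again a Gaussian on the lattice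
of step 2a, with variance V/r. Enlarging the sum to all of ℤ and applying Poisson summation compares
it with the integral, with relative error governed by the dual sum `c`. -/
theorem lintegral_binLaw_le_of_tsum_le {a : ℝ} (ha : 0 < a) {m : ℕ} (hm : m ≠ 0) {A B r c : ℝ}
    (hrdef : r = 1 - 2 * A * (m * a ^ 2)) (hr : 0 < r)
    (hc : ∑' n : ℤ, Real.exp (-Real.pi * (2 * r / (Real.pi * m))⁻¹ * (n : ℝ) ^ 2) ≤ c) :
    ∫⁻ x, ENNReal.ofReal (Real.exp (A * x ^ 2 + B * x)) ∂binLaw a m ≤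
      ENNReal.ofReal (Real.exp (phi m) * c) *
        ∫⁻ x, ENNReal.ofReal (Real.exp (A * x ^ 2 + B * x)) ∂normalLaw (m * a ^ 2) := by
  have hmp : (0 : ℝ) < m := by positivity
  have hpi := Real.pi_pos
  set V : ℝ := m * a ^ 2 with hVdef
  have hV : 0 < V := by positivity
  have hA : A = (1 - r) / (2 * V) := by rw [hrdef]; field_simp; ring
  set t := 2 * r / (Real.pi * m) with ht
  have htp : 0 < t := by positivity
  -- The support point a(2j - m) minus the tilted mean BV/r equals 2a(j + s), so its square over
  -- twice the variance V/r is πt(j + s)².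
  set s : ℝ := (-(m : ℝ) * a - B * V / r) / (2 * a) with hs
  have hterm : ∀ j ∈ Finset.range (m + 1),
      (m.choose j : ℝ≥0∞) * (2⁻¹ ^ m * ENNReal.ofReal
        (Real.exp (A * (a * (2 * j - m)) ^ 2 + B * (a * (2 * j - m))))) ≤
      ENNReal.ofReal (Real.exp (phi m) * Real.sqrt (2 / (Real.pi * m)) *
        Real.exp (B ^ 2 * V / (2 * r)) * Real.exp (-Real.pi * t * (((j : ℤ) : ℝ) + s) ^ 2)) := by
    intro j _
    have h2 : (m.choose j : ℝ≥0∞) * 2⁻¹ ^ m = ENNReal.ofReal ((m.choose j : ℝ) / 2 ^ m) := by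
      rw [div_eq_mul_inv, ENNReal.ofReal_mul (by positivity), ENNReal.ofReal_natCast, ← inv_pow,
        ENNReal.ofReal_pow (by norm_num), ENNReal.ofReal_inv_of_pos two_pos]
      simp
    rw [← mul_assoc, h2, ← ENNReal.ofReal_mul (by positivity)]
    refine ENNReal.ofReal_le_ofReal ?_
    refine (mul_le_mul_of_nonneg_right (choose_div_two_pow_le hm j) (Real.exp_pos _).le).trans ?_
    refine le_of_eq ?_
    rw [mul_assoc, mul_assoc, ← Real.exp_add, mul_assoc, mul_assoc, ← Real.exp_add]
    congr 3
    rw [hA, hs, ht, hVdef]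
    push_cast
    field_simp
    ring
  rw [lintegral_binLaw a m (by fun_prop), lintegral_exp_quadratic_normalLaw hV (by rwa [← hrdef]),
    ← hrdef]
  refine (Finset.sum_le_sum hterm).trans ?_
  rw [← ENNReal.ofReal_sum_of_nonneg (fun j _ => by positivity), ← Finset.mul_sum,
    ← ENNReal.ofReal_mul' (by positivity)]
  refine ENNReal.ofReal_le_ofReal ?_
  have hsum : ∑ j ∈ Finset.range (m + 1), Real.exp (-Real.pi * t * (((j : ℤ) : ℝ) + s) ^ 2) ≤
      ∑' n : ℤ, Real.exp (-Real.pi * t * ((n : ℝ) + s) ^ 2) := by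
    have := (summable_exp_neg_int_add_sq htp s).sum_le_tsum
      ((Finset.range (m + 1)).map Nat.castEmbedding) (fun _ _ => (Real.exp_pos _).le)
    simpa using this
  have h3 := hsum.trans ((tsum_exp_neg_int_add_sq_le htp s).trans
    (mul_le_mul_of_nonneg_left hc (by positivity)))
  have e : Real.sqrt (2 / (Real.pi * m)) * (1 / Real.sqrt t) = 1 / Real.sqrt r := by
    rw [ht, show 2 * r / (Real.pi * m) = 2 / (Real.pi * m) * r by ring,
      Real.sqrt_mul (by positivity)]
    field_simp
  calc _ ≤ Real.exp (phi m) * Real.sqrt (2 / (Real.pi * m)) * Real.exp (B ^ 2 * V / (2 * r)) *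
        (1 / Real.sqrt t * c) := by gcongr
    _ = Real.exp (phi m) * c * ((Real.sqrt (2 / (Real.pi * m)) * (1 / Real.sqrt t)) *
        Real.exp (B ^ 2 * V / (2 * r))) := by ring
    _ = _ := by rw [e]

theorem lintegral_binLaw_le {a : ℝ} (ha : 0 < a) {m : ℕ} (hm : m ≠ 0) {A B : ℝ}
    (hr : 0 < 1 - 2 * A * (m * a ^ 2)) :
    ∫⁻ x, ENNReal.ofReal (Real.exp (A * x ^ 2 + B * x)) ∂binLaw a m ≤
      ENNReal.ofReal (Real.exp (phi m) * (1 + eta * (1 - 2 * A * (m * a ^ 2)) / m)) *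
        ∫⁻ x, ENNReal.ofReal (Real.exp (A * x ^ 2 + B * x)) ∂normalLaw (m * a ^ 2) :=
  lintegral_binLaw_le_of_tsum_le ha hm rfl hr (tsum_dual_le_of_pos (by positivity) hr)

theorem lintegral_binLaw_le_of_le_two {a : ℝ} (ha : 0 < a) {m : ℕ} (hm : m ≠ 0) {A B : ℝ}
    (hr : 0 < 1 - 2 * A * (m * a ^ 2)) (hr2 : 1 - 2 * A * (m * a ^ 2) ≤ 2) :
    ∫⁻ x, ENNReal.ofReal (Real.exp (A * x ^ 2 + B * x)) ∂binLaw a m ≤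
      ENNReal.ofReal (Real.exp (phi m) * (1 + eta / m)) *
        ∫⁻ x, ENNReal.ofReal (Real.exp (A * x ^ 2 + B * x)) ∂normalLaw (m * a ^ 2) :=
  lintegral_binLaw_le_of_tsum_le ha hm rfl hr (tsum_dual_le_of_le_two
    (by exact_mod_cast Nat.one_le_iff_ne_zero.2 hm) hr hr2)

/-! ### Exponential moments of the decoding statistics in one channel use -/

theorem lintegral_exp_quadratic_add_const (μ : Measure ℝ) (A B c : ℝ) :
    ∫⁻ x, ENNReal.ofReal (Real.exp (A * x ^ 2 + B * x + c)) ∂μ =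
      ENNReal.ofReal (Real.exp c) *
        ∫⁻ x, ENNReal.ofReal (Real.exp (A * x ^ 2 + B * x)) ∂μ := by
  rw [← lintegral_const_mul _ (by fun_prop)]
  refine lintegral_congr fun x => ?_
  rw [← ENNReal.ofReal_mul (Real.exp_pos _).le, ← Real.exp_add, add_comm]

/-- D is the determinant of the rescaled 2 × 2 form. Integrating out x leaves the Schur complement
D/(1 - 2pV) for e. -/
theorem lintegral_exp_quadratic_two_normalLaw {V W : ℝ} (hV : 0 < V) (hW : 0 < W) {p q s D : ℝ}
    (hp : 0 < 1 - 2 * p * V) (hD : D = (1 - 2 * p * V) * (1 - 2 * s * W) - 4 * q ^ 2 * V * W)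
    (hD0 : 0 < D) :
    ∫⁻ e, ∫⁻ x, ENNReal.ofReal (Real.exp (p * x ^ 2 + 2 * q * e * x + s * e ^ 2))
        ∂normalLaw V ∂normalLaw W = ENNReal.ofReal (1 / Real.sqrt D) := by
  set r := 1 - 2 * p * V with hr
  have h1 : ∀ e : ℝ, ∫⁻ x, ENNReal.ofReal (Real.exp (p * x ^ 2 + 2 * q * e * x + s * e ^ 2))
      ∂normalLaw V = ENNReal.ofReal (1 / Real.sqrt r) *
        ENNReal.ofReal (Real.exp ((s + 2 * q ^ 2 * V / r) * e ^ 2 + 0 * e)) := by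
    intro e
    rw [lintegral_exp_quadratic_add_const, lintegral_exp_quadratic_normalLaw hV hp,
      ← ENNReal.ofReal_mul (Real.exp_pos _).le, ← ENNReal.ofReal_mul (by positivity),
      mul_left_comm, ← Real.exp_add]
    congr 3
    rw [← hr]
    field_simp
    ring
  have hre : r * (1 - 2 * (s + 2 * q ^ 2 * V / r) * W) = D := by
    rw [hD]; field_simp; ring
  have hre0 : 0 < 1 - 2 * (s + 2 * q ^ 2 * V / r) * W := by
    by_contra h
    have := mul_nonpos_of_nonneg_of_nonpos hp.le (not_lt.1 h)
    linarith
  simp_rw [h1]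
  rw [lintegral_const_mul _ (by fun_prop), lintegral_exp_quadratic_normalLaw hW hre0,
    ← ENNReal.ofReal_mul (by positivity), ← hre, Real.sqrt_mul hp.le]
  congr 1
  simp
  ring

/-- The average over a rival's fresh columns: convolving a Gaussian kernel of variance s with the
signs gives nearly one of variance s + ma². Here r = 1 + ma²/s may exceed 2, so it stays in the
error; this is the source of 1 + v in ι₃. -/
theorem lintegral_exp_neg_sq_binLaw_le {a : ℝ} (ha : 0 < a) {m : ℕ} (hm : m ≠ 0) {s : ℝ}
    (hs : 0 < s) (w : ℝ) :
    ∫⁻ z, ENNReal.ofReal (Real.exp (-((w - z) ^ 2 / (2 * s)))) ∂binLaw a m ≤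
      ENNReal.ofReal (Real.exp (phi m) * (1 + eta * (1 + m * a ^ 2 / s) / m) /
        Real.sqrt (1 + m * a ^ 2 / s)) *
      ENNReal.ofReal (Real.exp (-(w ^ 2 / (2 * (s + m * a ^ 2))))) := by
  have hmp : (0 : ℝ) < m := by positivity
  set V : ℝ := m * a ^ 2 with hVdef
  have hV : 0 < V := by positivity
  have hrd : 1 - 2 * (-(1 / (2 * s))) * V = 1 + V / s := by field_simp; ring
  have hr : 0 < 1 - 2 * (-(1 / (2 * s))) * V := by rw [hrd]; positivity
  have e : ∀ z : ℝ, -((w - z) ^ 2 / (2 * s)) =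
      -(1 / (2 * s)) * z ^ 2 + w / s * z + -(w ^ 2 / (2 * s)) := by
    intro z; field_simp; ring
  simp_rw [e]
  rw [lintegral_exp_quadratic_add_const]
  have h := lintegral_binLaw_le ha hm (A := -(1 / (2 * s))) (B := w / s) hr
  rw [← hVdef, lintegral_exp_quadratic_normalLaw hV hr, hrd] at h
  refine (mul_le_mul_right h _).trans (le_of_eq ?_)
  have heta := eta_nonneg
  rw [← ENNReal.ofReal_mul (by positivity), ← ENNReal.ofReal_mul (by positivity),
    ← ENNReal.ofReal_mul (by positivity)]
  congr 1
  have e2 : Real.exp (-(w ^ 2 / (2 * s))) * Real.exp ((w / s) ^ 2 * V / (2 * (1 + V / s)))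
      = Real.exp (-(w ^ 2 / (2 * (s + V)))) := by
    rw [← Real.exp_add]
    congr 1
    field_simp
    ring
  rw [← e2]
  ring

theorem one_sub_sq_mul_pos {P s α lam : ℝ} (hP : 0 < P) (hs : 0 < s) (hα : 0 < α)
    (hα1 : α ≤ 1) (hl0 : 0 ≤ lam) (hl1 : lam ≤ 1) :
    0 < 1 - lam ^ 2 * (α * (1 - α) * P / (s + α * P)) := by
  have hA : 0 < s + α * P := by positivity
  have h1 : α * (1 - α) * P / (s + α * P) < 1 := by
    rw [div_lt_one hA]
    nlinarith [mul_pos hα hP, mul_nonneg (mul_nonneg hα.le hα.le) hP.le]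
  have h0 : 0 ≤ α * (1 - α) * P / (s + α * P) := by
    have : 0 ≤ 1 - α := by linarith
    positivity
  have : lam ^ 2 ≤ 1 := pow_le_one₀ hl0 hl1
  nlinarith

/-- The Gaussian exponential moment of the statistic that separates a sent message from a decoded
one. -/
theorem lintegral_exp_decoding_normalLaw {P s α lam : ℝ} (hP : 0 < P) (hs : 0 < s) (hα : 0 < α)
    (hα1 : α < 1) (hl0 : 0 ≤ lam) (hl1 : lam ≤ 1) :
    ∫⁻ e, ∫⁻ x, ∫⁻ y, ENNReal.ofReal (Real.exp (lam *
        ((e + α * (x + y)) ^ 2 / (2 * (s + α ^ 2 * P)) - (e + x) ^ 2 / (2 * (s + α * P)))))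
        ∂normalLaw ((1 - α) * P) ∂normalLaw (α * P) ∂normalLaw s =
      ENNReal.ofReal (1 / Real.sqrt (1 - lam ^ 2 * (α * (1 - α) * P / (s + α * P)))) := by
  have hα' : 0 < 1 - α := by linarith
  set A := s + α * P with hA
  set B := s + α ^ 2 * P with hB
  have hA0 : 0 < A := by positivity
  have hB0 : 0 < B := by positivity
  -- b/B is the factor 1 - 2AV for the integration over y, and b/α² then appears in the coefficients
  -- of x and e. It is positive because λ ≤ 1 gives b ≥ s + α³P.
  set b := B - lam * α ^ 2 * ((1 - α) * P) with hb
  have hb1 : s + α ^ 3 * P ≤ b := by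
    have : 0 ≤ (1 - lam) * (α ^ 2 * (1 - α) * P) :=
      mul_nonneg (by linarith) (by positivity)
    rw [hb, hB]; nlinarith
  have hb0 : 0 < b := lt_of_lt_of_le (by positivity) hb1
  have hry : 1 - 2 * (lam / (2 * B)) * α ^ 2 * ((1 - α) * P) = b / B := by
    rw [hb]; field_simp
  have hy : ∀ e x : ℝ, ∫⁻ y, ENNReal.ofReal (Real.exp (lam *
        ((e + α * (x + y)) ^ 2 / (2 * B) - (e + x) ^ 2 / (2 * A))))
        ∂normalLaw ((1 - α) * P) = ENNReal.ofReal (1 / Real.sqrt (b / B)) *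
      ENNReal.ofReal (Real.exp (lam / 2 * (α ^ 2 / b - 1 / A) * x ^ 2
        + 2 * (lam / 2 * (α / b - 1 / A)) * e * x + lam / 2 * (1 / b - 1 / A) * e ^ 2)) := by
    intro e x
    have h := lintegral_exp_sq_normalLaw (V := (1 - α) * P) (by positivity) (κ := lam / (2 * B))
      (u := e + α * x) (θ := α) (by rw [hry]; positivity)
    rw [hry] at h
    have e1 : ∀ y : ℝ, ENNReal.ofReal (Real.exp (lam *
        ((e + α * (x + y)) ^ 2 / (2 * B) - (e + x) ^ 2 / (2 * A)))) =
        ENNReal.ofReal (Real.exp (-(lam * ((e + x) ^ 2 / (2 * A))))) *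
        ENNReal.ofReal (Real.exp (lam / (2 * B) * (e + α * x + α * y) ^ 2)) := by
      intro y
      rw [← ENNReal.ofReal_mul (Real.exp_pos _).le, ← Real.exp_add]
      congr 2; ring
    simp_rw [e1]
    rw [lintegral_const_mul _ (by fun_prop), h, ← ENNReal.ofReal_mul (Real.exp_pos _).le,
      ← ENNReal.ofReal_mul (by positivity), mul_left_comm, ← Real.exp_add]
    congr 3
    field_simp
    ring
  simp_rw [hy]
  have hm : ∀ e : ℝ, Measurable fun x : ℝ => ENNReal.ofReal (Real.exp (lam / 2 * (α ^ 2 / b - 1 / A)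
      * x ^ 2 + 2 * (lam / 2 * (α / b - 1 / A)) * e * x + lam / 2 * (1 / b - 1 / A) * e ^ 2)) :=
    fun e => by fun_prop
  simp_rw [lintegral_const_mul _ (hm _)]
  have hq := one_sub_sq_mul_pos hP hs hα hα1.le hl0 hl1
  rw [← hA] at hq
  have hp : 0 < 1 - 2 * (lam / 2 * (α ^ 2 / b - 1 / A)) * (α * P) := by
    have h1 : α ^ 2 / b * (α * P) < 1 := by
      rw [div_mul_eq_mul_div, div_lt_one hb0]; nlinarith
    have h2 : 0 ≤ 1 / A * (α * P) := by positivity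
    have h3 : 0 ≤ α ^ 2 / b * (α * P) := by positivity
    have h4 : lam * (α ^ 2 / b * (α * P)) ≤ α ^ 2 / b * (α * P) := mul_le_of_le_one_left h3 hl1
    have h5 : 0 ≤ lam * (1 / A * (α * P)) := by positivity
    nlinarith
  have hprod : b / B * ((1 - 2 * (lam / 2 * (α ^ 2 / b - 1 / A)) * (α * P)) *
      (1 - 2 * (lam / 2 * (1 / b - 1 / A)) * s)
      - 4 * (lam / 2 * (α / b - 1 / A)) ^ 2 * (α * P) * s) =
      1 - lam ^ 2 * (α * (1 - α) * P / A) := by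
    field_simp
    rw [hb, hA, hB]
    ring
  have hD0 : 0 < (1 - 2 * (lam / 2 * (α ^ 2 / b - 1 / A)) * (α * P)) *
      (1 - 2 * (lam / 2 * (1 / b - 1 / A)) * s)
      - 4 * (lam / 2 * (α / b - 1 / A)) ^ 2 * (α * P) * s :=
    pos_of_mul_pos_right (by rw [hprod]; exact hq) (by positivity)
  rw [lintegral_const_mul _ (by fun_prop), lintegral_exp_quadratic_two_normalLaw (by positivity) hs
    hp rfl hD0, ← ENNReal.ofReal_mul (by positivity), ← hprod, Real.sqrt_mul (by positivity)]
  congr 1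
  rw [one_div_mul_one_div]

/-- The y² coefficient is nonnegative, so y is replaced by a Gaussian without loss. The x²
coefficient can be negative, and replacing x costs one factor. Doing x first and then exchanging the
integrals keeps both integrands exponentials of quadratics. -/
theorem lintegral_exp_decoding_le {a P s α lam : ℝ} (ha : 0 < a) (hP : 0 < P) (hs : 0 < s)
    (hα : 0 < α) (hα1 : α < 1) (hl0 : 0 ≤ lam) (hl1 : lam ≤ 1) {m₁ m₂ : ℕ} (hm : m₁ ≠ 0)
    (h₁ : m₁ * a ^ 2 = α * P) (h₂ : m₂ * a ^ 2 = (1 - α) * P) :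
    ∫⁻ e, ∫⁻ y, ∫⁻ x, ENNReal.ofReal (Real.exp (lam *
        ((e + α * (x + y)) ^ 2 / (2 * (s + α ^ 2 * P)) - (e + x) ^ 2 / (2 * (s + α * P)))))
        ∂binLaw a m₁ ∂binLaw a m₂ ∂normalLaw s ≤
      ENNReal.ofReal (Real.exp (phi m₁) * (1 + eta / m₁)) *
      ENNReal.ofReal (1 / Real.sqrt (1 - lam ^ 2 * (α * (1 - α) * P / (s + α * P)))) := by
  rw [← lintegral_exp_decoding_normalLaw hP hs hα hα1 hl0 hl1]
  set A := s + α * P with hA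
  set B := s + α ^ 2 * P with hB
  have hA0 : 0 < A := by positivity
  have hB0 : 0 < B := by positivity
  have hx : ∀ e y : ℝ, ∫⁻ x, ENNReal.ofReal (Real.exp (lam *
      ((e + α * (x + y)) ^ 2 / (2 * B) - (e + x) ^ 2 / (2 * A)))) ∂binLaw a m₁ ≤
      ENNReal.ofReal (Real.exp (phi m₁) * (1 + eta / m₁)) *
      ∫⁻ x, ENNReal.ofReal (Real.exp (lam *
      ((e + α * (x + y)) ^ 2 / (2 * B) - (e + x) ^ 2 / (2 * A)))) ∂normalLaw (α * P) := by
    intro e y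
    have e1 : ∀ x : ℝ, lam * ((e + α * (x + y)) ^ 2 / (2 * B) - (e + x) ^ 2 / (2 * A)) =
        lam / 2 * (α ^ 2 / B - 1 / A) * x ^ 2 + lam * (α * (e + α * y) / B - e / A) * x
        + lam * ((e + α * y) ^ 2 / (2 * B) - e ^ 2 / (2 * A)) := by
      intro x; field_simp; ring
    simp_rw [e1]
    rw [lintegral_exp_quadratic_add_const, lintegral_exp_quadratic_add_const, ← h₁,
      mul_left_comm]
    have hV : α ^ 2 / B * (α * P) ≤ 1 := by
      rw [div_mul_eq_mul_div, div_le_one hB0, hB]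
      have : 0 ≤ α ^ 2 * P * (1 - α) := mul_nonneg (by positivity) (by linarith)
      nlinarith
    have hV1 : 1 / A * (α * P) ≤ 1 := by
      rw [div_mul_eq_mul_div, div_le_one hA0, hA]; linarith
    have hV0 : 0 < 1 / A * (α * P) := by positivity
    have hV2 : 0 < α ^ 2 / B * (α * P) := by positivity
    have hr : 1 - 2 * (lam / 2 * (α ^ 2 / B - 1 / A)) * (m₁ * a ^ 2)
        = 1 - lam * (α ^ 2 / B * (α * P)) + lam * (1 / A * (α * P)) := by rw [h₁]; ring
    refine mul_le_mul_right (lintegral_binLaw_le_of_le_two ha hm ?_ ?_) _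
    · rw [hr]
      rcases hl0.eq_or_lt with h | h
      · rw [← h]; norm_num
      · nlinarith
    · rw [hr]; nlinarith
  have hy : ∀ e x : ℝ, ∫⁻ y, ENNReal.ofReal (Real.exp (lam *
      ((e + α * (x + y)) ^ 2 / (2 * B) - (e + x) ^ 2 / (2 * A)))) ∂binLaw a m₂ ≤
      ∫⁻ y, ENNReal.ofReal (Real.exp (lam *
      ((e + α * (x + y)) ^ 2 / (2 * B) - (e + x) ^ 2 / (2 * A)))) ∂normalLaw ((1 - α) * P) := by
    intro e x
    have e1 : ∀ y : ℝ, lam * ((e + α * (x + y)) ^ 2 / (2 * B) - (e + x) ^ 2 / (2 * A)) =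
        lam / 2 * (α ^ 2 / B) * y ^ 2 + lam * α * (e + α * x) / B * y
        + lam * ((e + α * x) ^ 2 / (2 * B) - (e + x) ^ 2 / (2 * A)) := by
      intro y; field_simp; ring
    simp_rw [e1]
    rw [lintegral_exp_quadratic_add_const, lintegral_exp_quadratic_add_const, ← h₂]
    exact mul_le_mul_right (lintegral_binLaw_le_of_nonneg a m₂ (by positivity) _) _
  rw [← lintegral_const_mul _ (by fun_prop)]
  refine lintegral_mono fun e => ?_
  refine (lintegral_mono fun y => hx e y).trans ?_
  rw [lintegral_const_mul _ (by fun_prop), lintegral_lintegral_swap (by fun_prop)]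
  exact mul_le_mul_right (lintegral_mono fun x => hy e x) _

theorem lintegral_exp_sent_le {a P s α lam : ℝ} (ha : 0 < a) (hP : 0 < P) (hs : 0 < s)
    (hα : 0 < α) (hl0 : 0 ≤ lam)
    (hl : 0 < 1 - lam ^ 2 * (α ^ 2 * P / (s + α ^ 2 * P))) {m : ℕ} (hm : m ≠ 0)
    (h : m * a ^ 2 = P) :
    ∫⁻ e, ∫⁻ x, ENNReal.ofReal (Real.exp (lam *
        (e ^ 2 / (2 * s) - (e + α * x) ^ 2 / (2 * (s + α ^ 2 * P)))))
        ∂binLaw a m ∂normalLaw s ≤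
      ENNReal.ofReal (Real.exp (phi m) * (1 + eta / m)) *
      ENNReal.ofReal (1 / Real.sqrt (1 - lam ^ 2 * (α ^ 2 * P / (s + α ^ 2 * P)))) := by
  set B := s + α ^ 2 * P with hB
  have hB0 : 0 < B := by positivity
  have e1 : ∀ e x : ℝ, lam * (e ^ 2 / (2 * s) - (e + α * x) ^ 2 / (2 * B)) =
      -(lam / 2 * (α ^ 2 / B)) * x ^ 2 + 2 * (-(lam / 2 * (α / B))) * e * x
        + lam / 2 * (1 / s - 1 / B) * e ^ 2 := by
    intro e x; field_simp; ring
  simp_rw [e1]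
  set Q := α ^ 2 * P / B with hQ
  have hQ0 : 0 < Q := by positivity
  have hQ1 : Q < 1 := by rw [hQ, div_lt_one hB0, hB]; linarith
  -- Although λ may exceed 1 here, λ²Q < 1 and Q < 1 force λQ ≤ 1; thus 1 + λQ ≤ 2 and the error has
  -- no factor r.
  have hlQ : lam * Q ≤ 1 := by
    rcases le_total lam 1 with h' | h' <;> nlinarith
  have hr : 1 - 2 * (-(lam / 2 * (α ^ 2 / B))) * P = 1 + lam * Q := by rw [hQ]; ring
  have hp : 0 < 1 - 2 * (-(lam / 2 * (α ^ 2 / B))) * P := by rw [hr]; positivity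
  rw [← lintegral_exp_quadratic_two_normalLaw (p := -(lam / 2 * (α ^ 2 / B)))
    (q := -(lam / 2 * (α / B))) (s := lam / 2 * (1 / s - 1 / B)) hP hs hp ?_ hl,
    ← lintegral_const_mul _ (by fun_prop)]
  · refine lintegral_mono fun e => ?_
    simp only
    rw [lintegral_exp_quadratic_add_const, lintegral_exp_quadratic_add_const, mul_left_comm]
    refine mul_le_mul_right ?_ _
    rw [← h]
    refine lintegral_binLaw_le_of_le_two ha hm ?_ ?_ <;> rw [h, hr]
    · positivity
    · linarith
  · rw [hQ]
    field_simp
    rw [hB]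
    ring

/-! ### Independent rows and sums over disjoint sets of columns -/

theorem lintegral_prod_pi {n : ℕ} {E : Type*} [MeasurableSpace E] (μ : Measure E)
    [IsProbabilityMeasure μ] {f : Fin n → E → ℝ≥0∞} (hf : ∀ i, Measurable (f i)) :
    ∫⁻ x, ∏ i, f i (x i) ∂(Measure.pi fun _ : Fin n => μ) = ∏ i, ∫⁻ x, f i x ∂μ := by
  have hind : iIndepFun (fun (i : Fin n) (x : Fin n → E) => f i (x i))
      (Measure.pi fun _ : Fin n => μ) := iIndepFun_pi fun i => (hf i).aemeasurable
  rw [lintegral_prod_eq_prod_lintegral_of_indepFun Finset.univ _ hind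
    (fun i => (hf i).comp (measurable_pi_apply i))]
  refine Finset.prod_congr rfl fun i _ => ?_
  have h := measurePreserving_eval (fun _ : Fin n => μ) i
  rw [← h.map_eq, lintegral_map (hf i) (measurable_pi_apply i)]
  simp only [h.map_eq, Function.eval]

theorem lintegral_prod_rows {n : ℕ} {E F : Type*} [MeasurableSpace E] [MeasurableSpace F]
    (μ : Measure E) (ν : Measure F) [IsProbabilityMeasure μ] [IsProbabilityMeasure ν]
    {G : E → F → ℝ≥0∞} (hG : Measurable (Function.uncurry G)) :
    ∫⁻ ω, ∏ i, G (ω.1 i) (ω.2 i)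
      ∂((Measure.pi fun _ : Fin n => μ).prod (Measure.pi fun _ : Fin n => ν)) =
      (∫⁻ e, ∫⁻ r, G r e ∂μ ∂ν) ^ n := by
  have hm : Measurable fun ω : (Fin n → E) × (Fin n → F) => ∏ i, G (ω.1 i) (ω.2 i) := by
    refine Finset.measurable_prod _ fun i _ => ?_
    exact hG.comp (f := fun ω : (Fin n → E) × (Fin n → F) => (ω.1 i, ω.2 i)) (by fun_prop)
  rw [lintegral_prod_symm' _ hm]
  have h1 : ∀ b : Fin n → F, ∫⁻ x, ∏ i, G (x i) (b i) ∂(Measure.pi fun _ : Fin n => μ) =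
      ∏ i, ∫⁻ r, G r (b i) ∂μ := fun b =>
    lintegral_prod_pi μ (f := fun i r => G r (b i)) fun i => hG.comp measurable_prodMk_right
  simp_rw [h1]
  rw [lintegral_prod_pi ν (f := fun _ e => ∫⁻ r, G r e ∂μ)
    (fun _ => Measurable.lintegral_prod_left' (f := Function.uncurry G) hG)]
  simp

section Signs

variable {ι : Type*} [Fintype ι]

theorem iIndepFun_signs (a : ℝ) :
    iIndepFun (fun (i : ι) (r : ι → ℝ) => r i) (Measure.pi fun _ : ι => signLaw a) :=
  iIndepFun_pi (X := fun _ => id) fun _ => aemeasurable_id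

theorem map_sum_signs (a : ℝ) (I : Finset ι) :
    (Measure.pi fun _ : ι => signLaw a).map (fun r => ∑ i ∈ I, r i) = binLaw a I.card := by
  classical
  induction I using Finset.induction_on with
  | empty => simp [binLaw]
  | insert i I hi ih =>
    have hind := (iIndepFun_signs (ι := ι) a).indepFun_finsetSum_of_notMem
      (fun i => measurable_pi_apply i) hi
    have hm : Measurable (∑ j ∈ I, fun r : ι → ℝ => r j) :=
      by fun_prop
    have h := hind.symm.map_add_eq_map_conv_map (measurable_pi_apply i) hm
    have e : (fun r : ι → ℝ => r i) + (∑ j ∈ I, fun r : ι → ℝ => r j)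
        = fun r => ∑ j ∈ insert i I, r j := by
      funext r
      simp [Finset.sum_insert hi]
    have e2 : (∑ j ∈ I, fun r : ι → ℝ => r j) = fun r => ∑ j ∈ I, r j := by
      funext r; simp
    rw [e, e2, ih, (measurePreserving_eval (fun _ : ι => signLaw a) i).map_eq] at h
    rw [h, Finset.card_insert_of_notMem hi, binLaw]

theorem indepFun_comp_signs (a : ℝ) {I J : Finset ι} (hIJ : Disjoint I J)
    {β γ : Type*} [MeasurableSpace β] [MeasurableSpace γ] {f : (I → ℝ) → β} {g : (J → ℝ) → γ}
    (hf : Measurable f) (hg : Measurable g) :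
    IndepFun (fun r : ι → ℝ => f fun i => r i) (fun r : ι → ℝ => g fun i => r i)
      (Measure.pi fun _ : ι => signLaw a) :=
  ((iIndepFun_signs (ι := ι) a).indepFun_finset I J hIJ
    (fun i => measurable_pi_apply i)).comp hf hg

theorem lintegral_signs_one (a : ℝ) (I : Finset ι) {F : ℝ → ℝ≥0∞} (hF : Measurable F) :
    ∫⁻ r, F (∑ i ∈ I, r i) ∂(Measure.pi fun _ : ι => signLaw a) =
      ∫⁻ x, F x ∂binLaw a I.card := by
  rw [← map_sum_signs, lintegral_map hF (by fun_prop)]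

theorem lintegral_signs_two (a : ℝ) {I J : Finset ι} (hIJ : Disjoint I J)
    {F : ℝ → ℝ → ℝ≥0∞} (hF : Measurable (Function.uncurry F)) :
    ∫⁻ r, F (∑ i ∈ I, r i) (∑ i ∈ J, r i) ∂(Measure.pi fun _ : ι => signLaw a) =
      ∫⁻ y, ∫⁻ x, F x y ∂binLaw a I.card ∂binLaw a J.card := by
  have hind := indepFun_comp_signs a hIJ (f := fun r => ∑ i, r i) (g := fun r => ∑ i, r i)
    (by fun_prop) (by fun_prop)
  simp only [Finset.sum_coe_sort I, Finset.sum_coe_sort J] at hind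
  have h := (indepFun_iff_map_prod_eq_prod_map_map (by fun_prop) (by fun_prop)).1 hind
  rw [map_sum_signs, map_sum_signs] at h
  refine Eq.trans ?_ (lintegral_prod_symm' (Function.uncurry F) hF)
  rw [← h, lintegral_map hF (by fun_prop)]
  rfl

theorem lintegral_signs_three (a : ℝ) {I J K : Finset ι} (hIJ : Disjoint I J) (hIK : Disjoint I K)
    (hJK : Disjoint J K) {F : ℝ → ℝ → ℝ → ℝ≥0∞}
    (hF : Measurable fun p : ℝ × ℝ × ℝ => F p.1 p.2.1 p.2.2) :
    ∫⁻ r, F (∑ i ∈ I, r i) (∑ i ∈ J, r i) (∑ i ∈ K, r i)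
        ∂(Measure.pi fun _ : ι => signLaw a) =
      ∫⁻ y, ∫⁻ x, ∫⁻ z, F x y z ∂binLaw a K.card ∂binLaw a I.card ∂binLaw a J.card := by
  classical
  have hIJK : Disjoint K (I ∪ J) :=
    Finset.disjoint_union_right.2 ⟨hIK.symm, hJK.symm⟩
  have hm : Measurable fun r : ((I ∪ J : Finset ι) → ℝ) =>
      ((∑ i : I, r ⟨i, Finset.mem_union_left _ i.2⟩),
        (∑ i : J, r ⟨i, Finset.mem_union_right _ i.2⟩)) := by fun_prop
  have hind := indepFun_comp_signs a hIJK (f := fun r => ∑ i, r i) (by fun_prop) hm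
  simp only [Finset.sum_coe_sort K, Finset.sum_coe_sort I, Finset.sum_coe_sort J] at hind
  have h := (indepFun_iff_map_prod_eq_prod_map_map (by fun_prop) (by fun_prop)).1 hind
  rw [map_sum_signs] at h
  have hF' : Measurable fun p : ℝ × ℝ × ℝ => F p.2.1 p.2.2 p.1 :=
    hF.comp (f := fun p : ℝ × ℝ × ℝ => (p.2.1, p.2.2, p.1)) (by fun_prop)
  have h2 : ∫⁻ r, F (∑ i ∈ I, r i) (∑ i ∈ J, r i) (∑ i ∈ K, r i)
      ∂(Measure.pi fun _ : ι => signLaw a) = ∫⁻ p, F p.2.1 p.2.2 p.1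
        ∂((Measure.pi fun _ : ι => signLaw a).map
          fun r => (∑ i ∈ K, r i, (∑ i ∈ I, r i, ∑ i ∈ J, r i))) := by
    rw [lintegral_map hF' (by fun_prop)]
  have hprob : IsProbabilityMeasure ((Measure.pi fun _ : ι => signLaw a).map
      fun r => (∑ i ∈ I, r i, ∑ i ∈ J, r i)) :=
    Measure.isProbabilityMeasure_map (by fun_prop)
  rw [h2, h, lintegral_prod_symm' _ hF', lintegral_map
    (Measurable.lintegral_prod_left' (f := fun p : ℝ × ℝ × ℝ => F p.2.1 p.2.2 p.1) hF')
    (by fun_prop)]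
  exact lintegral_signs_two a hIJ (F := fun x y => ∫⁻ z, F x y z ∂binLaw a K.card)
    (Measurable.lintegral_prod_left' (f := fun p : ℝ × ℝ × ℝ => F p.2.1 p.2.2 p.1) hF')

end Signs

/-! ### Messages as choices of one column per section -/

theorem exists_selection {L M : ℕ} {β : Col L M → ℝ} (hβ : β ∈ messages L M) :
    ∃ f : Fin L → Fin M, ∀ s m, β (s, m) = if m = f s then 1 else 0 := by
  choose f hf hu using hβ.2
  refine ⟨f, fun s m => ?_⟩
  split_ifs with h
  · rw [h]; exact hf s
  · exact (hβ.1 (s, m)).resolve_right fun h1 => h (hu s m h1)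

/-- The signs that belong to the columns selected by `f` in the sections in `D`. -/
def signIndices {L M : ℕ} (d : ℕ) (D : Finset (Fin L)) (f : Fin L → Fin M) :
    Finset (Col L M × Fin d) :=
  (D ×ˢ (Finset.univ : Finset (Fin d))).map
    ⟨fun p => ((p.1, f p.1), p.2), fun p q h => by
      simp only [Prod.mk.injEq] at h
      exact Prod.ext h.1.1 h.2⟩

theorem mem_signIndices {L M d : ℕ} {D : Finset (Fin L)} {f : Fin L → Fin M}
    {p : Col L M × Fin d} : p ∈ signIndices d D f ↔ p.1.1 ∈ D ∧ p.1.2 = f p.1.1 := by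
  simp only [signIndices, Finset.mem_map, Finset.mem_product, Finset.mem_univ, and_true,
    Prod.exists]
  constructor
  · rintro ⟨s, k, hs, rfl⟩; exact ⟨hs, rfl⟩
  · rintro ⟨h1, h2⟩
    exact ⟨p.1.1, p.2, h1, Prod.ext (Prod.ext rfl h2.symm) rfl⟩

theorem card_signIndices {L M d : ℕ} (D : Finset (Fin L)) (f : Fin L → Fin M) :
    (signIndices d D f).card = d * D.card := by
  simp [signIndices, mul_comm]

theorem sum_signIndices {L M d : ℕ} (D : Finset (Fin L)) (f : Fin L → Fin M)
    (r : Col L M × Fin d → ℝ) :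
    ∑ p ∈ signIndices d D f, r p = ∑ s ∈ D, ∑ k, r ((s, f s), k) := by
  rw [signIndices, Finset.sum_map, Finset.sum_product]
  rfl

theorem disjoint_signIndices_of_disjoint {L M d : ℕ} {D D' : Finset (Fin L)} (h : Disjoint D D')
    (f f' : Fin L → Fin M) : Disjoint (signIndices d D f) (signIndices d D' f') := by
  rw [Finset.disjoint_left]
  intro p hp hp'
  exact Finset.disjoint_left.1 h (mem_signIndices.1 hp).1 (mem_signIndices.1 hp').1

theorem disjoint_signIndices_of_ne {L M d : ℕ} {D : Finset (Fin L)} {f f' : Fin L → Fin M}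
    (h : ∀ s ∈ D, f' s ≠ f s) : Disjoint (signIndices d D f) (signIndices d D f') := by
  rw [Finset.disjoint_left]
  intro p hp hp'
  obtain ⟨h1, h2⟩ := mem_signIndices.1 hp
  exact h _ h1 ((mem_signIndices.1 hp').2.symm.trans h2)

theorem dictionary_mulVec {n L M d : ℕ} {β : Col L M → ℝ} {f : Fin L → Fin M}
    (hf : ∀ s m, β (s, m) = if m = f s then 1 else 0) (ω : Sample n L M d) (i : Fin n) :
    (dictionary ω).mulVec β i = ∑ p ∈ signIndices d Finset.univ f, ω.1 i p := by
  rw [sum_signIndices, Matrix.mulVec, dotProduct, Fintype.sum_prod_type]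
  refine Finset.sum_congr rfl fun s _ => ?_
  simp [hf, dictionary]

theorem sum_signIndices_univ {L M d : ℕ} (D : Finset (Fin L)) (f : Fin L → Fin M)
    (r : Col L M × Fin d → ℝ) :
    ∑ p ∈ signIndices d Finset.univ f, r p =
      ∑ p ∈ signIndices d D f, r p + ∑ p ∈ signIndices d Dᶜ f, r p := by
  simp_rw [sum_signIndices]
  exact (Finset.sum_add_sum_compl D _).symm

theorem mistakes_eq {L M : ℕ} {β β' : Col L M → ℝ} {f f' : Fin L → Fin M}
    (hf : ∀ s m, β (s, m) = if m = f s then 1 else 0)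
    (hf' : ∀ s m, β' (s, m) = if m = f' s then 1 else 0) :
    mistakes β' β = (Finset.univ.filter fun s => f' s ≠ f s).card := by
  unfold mistakes
  congr 1
  ext s
  simp only [Finset.mem_filter, Finset.mem_univ, true_and]
  constructor
  · rintro ⟨m, hm⟩ h
    exact hm (by rw [hf, hf', h])
  · intro h
    refine ⟨f s, ?_⟩
    rw [hf, hf', if_pos rfl, if_neg (fun h' => h h'.symm)]
    norm_num

/-- The selections that differ from `f` exactly in the sections in `D`. -/
def rivals {L M : ℕ} (D : Finset (Fin L)) (f : Fin L → Fin M) : Finset (Fin L → Fin M) :=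
  Finset.univ.filter fun f' => (∀ s ∈ D, f' s ≠ f s) ∧ ∀ s ∈ Dᶜ, f' s = f s

theorem card_rivals_le {L M : ℕ} (D : Finset (Fin L)) (f : Fin L → Fin M) :
    (rivals D f).card ≤ M ^ D.card := by
  classical
  have h : rivals D f ⊆ Fintype.piFinset fun s => if s ∈ D then Finset.univ else {f s} := by
    intro f' hf'
    simp only [rivals, Finset.mem_filter, Finset.mem_univ, true_and, Finset.mem_compl] at hf'
    rw [Fintype.mem_piFinset]
    intro s
    split_ifs with hs
    · simp
    · simpa using hf'.2 s hs
  refine (Finset.card_le_card h).trans (le_of_eq ?_)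
  rw [Fintype.card_piFinset]
  have : ∀ s, (if s ∈ D then (Finset.univ : Finset (Fin M)) else {f s}).card
      = if s ∈ D then M else 1 := by
    intro s; split_ifs <;> simp
  simp_rw [this]
  rw [Finset.prod_ite_mem, Finset.univ_inter, Finset.prod_const]

/-! ### The two large deviation bounds -/

theorem prod_ofReal_exp {n : ℕ} (f : Fin n → ℝ) :
    ∏ i, ENNReal.ofReal (Real.exp (f i)) = ENNReal.ofReal (Real.exp (∑ i, f i)) := by
  rw [Real.exp_sum, ENNReal.ofReal_prod_of_nonneg fun i _ => (Real.exp_pos _).le]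

/-- S need not be measurable: nothing is assumed about measurability of the decoder, and only a
measurable majorant of the event is used. -/
theorem measure_le_lintegral_of_one_le {Ω : Type*} [MeasurableSpace Ω] (μ : Measure Ω) {S : Set Ω}
    {H : Ω → ℝ≥0∞} (hH : Measurable H) (h : ∀ ω ∈ S, 1 ≤ H ω) : μ S ≤ ∫⁻ ω, H ω ∂μ := by
  have h1 := mul_meas_ge_le_lintegral (μ := μ) hH 1
  rw [one_mul] at h1
  exact (measure_mono h).trans h1

theorem sqrt_div_sq {P : ℝ} {d L : ℕ} (hP : 0 < P) (hd : 1 ≤ d) (hL : 2 ≤ L) (k : ℕ) :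
    ((d * k : ℕ) : ℝ) * Real.sqrt (P / (d * L)) ^ 2 = (k : ℝ) / L * P := by
  have hd' : (0 : ℝ) < d := by exact_mod_cast hd
  have hL' : (0 : ℝ) < L := by exact_mod_cast (by omega : 0 < L)
  rw [Real.sq_sqrt (by positivity)]
  push_cast
  field_simp

/-- Chernoff's bound: the rows are independent, so the exponential moment of the sum is the n-th
power of the one-row moment. -/
theorem jointLaw_sent_le {n L M d : ℕ} {P σ α : ℝ} (hL : 2 ≤ L) (hd : 1 ≤ d) (hP : 0 < P)
    (hσ : 0 < σ) (hα : 0 < α) (f : Fin L → Fin M) (t : ℝ) {lam : ℝ} (hl0 : 0 ≤ lam)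
    (hl : 0 < 1 - lam ^ 2 * (α ^ 2 * P / (σ ^ 2 + α ^ 2 * P))) :
    jointLaw n L M d P σ {ω | n * t ≤ ∑ i, (ω.2 i ^ 2 / (2 * σ ^ 2) -
        (ω.2 i + α * ∑ p ∈ signIndices d Finset.univ f, ω.1 i p) ^ 2
          / (2 * (σ ^ 2 + α ^ 2 * P)))} ≤
      ENNReal.ofReal ((Real.exp (-(lam * t)) * (Real.exp (phi (d * L)) * (1 + eta / (d * L))) *
        (1 / Real.sqrt (1 - lam ^ 2 * (α ^ 2 * P / (σ ^ 2 + α ^ 2 * P))))) ^ n) := by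
  set s := σ ^ 2 with hs
  have hs0 : 0 < s := by positivity
  set B := s + α ^ 2 * P with hB
  have hd' : (0 : ℝ) < d := by exact_mod_cast hd
  have hL' : (0 : ℝ) < L := by exact_mod_cast (by omega : 0 < L)
  set a := Real.sqrt (P / (d * L)) with ha
  have ha0 : 0 < a := by positivity
  set I := signIndices d Finset.univ f with hI
  set K : ℝ → ℝ → ℝ := fun x e => lam * (e ^ 2 / (2 * s) - (e + α * x) ^ 2 / (2 * B)) with hK
  have hKm : Measurable fun p : ℝ × ℝ => K p.1 p.2 := by rw [hK]; fun_prop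
  set G : (Col L M × Fin d → ℝ) → ℝ → ℝ≥0∞ := fun r e =>
    ENNReal.ofReal (Real.exp (-(lam * t) + K (∑ p ∈ I, r p) e)) with hG
  have hGm : Measurable (Function.uncurry G) := by
    refine ENNReal.measurable_ofReal.comp (Real.measurable_exp.comp (Measurable.const_add ?_ _))
    exact hKm.comp (f := fun q : (Col L M × Fin d → ℝ) × ℝ => (∑ p ∈ I, q.1 p, q.2)) (by fun_prop)
  have hrow : ∫⁻ e, ∫⁻ r, G r e ∂(Measure.pi fun _ : Col L M × Fin d => signLaw a) ∂normalLaw s ≤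
      ENNReal.ofReal (Real.exp (-(lam * t)) * (Real.exp (phi (d * L)) * (1 + eta / (d * L))) *
        (1 / Real.sqrt (1 - lam ^ 2 * (α ^ 2 * P / B)))) := by
    have h1 : ∀ e, ∫⁻ r, G r e ∂(Measure.pi fun _ : Col L M × Fin d => signLaw a) =
        ENNReal.ofReal (Real.exp (-(lam * t))) *
          ∫⁻ x, ENNReal.ofReal (Real.exp (K x e)) ∂binLaw a (d * L) := by
      intro e
      have hm : Measurable fun x => ENNReal.ofReal (Real.exp (K x e)) := by
        simp only [hK]; fun_prop
      have hc : I.card = d * L := by rw [hI, card_signIndices]; simp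
      rw [← hc, ← lintegral_signs_one a I hm, ← lintegral_const_mul _ (by fun_prop)]
      refine lintegral_congr fun r => ?_
      rw [hG, ← ENNReal.ofReal_mul (Real.exp_pos _).le, ← Real.exp_add]
    have hm2 : Measurable fun e => ∫⁻ x, ENNReal.ofReal (Real.exp (K x e)) ∂binLaw a (d * L) := by
      simp only [hK]; fun_prop
    simp_rw [h1]
    rw [lintegral_const_mul _ hm2]
    have h2 := lintegral_exp_sent_le ha0 hP hs0 hα hl0 hl (m := d * L)
      (Nat.mul_ne_zero (by omega) (by omega))
      (by rw [ha, sqrt_div_sq hP hd hL, div_self hL'.ne', one_mul])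
    have heta := eta_nonneg
    rw [mul_assoc, ENNReal.ofReal_mul (Real.exp_pos _).le]
    refine mul_le_mul_right ?_ _
    rw [ENNReal.ofReal_mul (by positivity)]
    push_cast at h2
    exact h2
  refine (measure_le_lintegral_of_one_le _ (H := fun ω => ∏ i, G (ω.1 i) (ω.2 i)) ?_ ?_).trans ?_
  · refine Finset.measurable_prod _ fun i _ => ?_
    exact hGm.comp (f := fun ω : Sample n L M d => (ω.1 i, ω.2 i)) (by fun_prop)
  · intro ω hω
    simp only [Set.mem_ofPred_eq] at hω
    rw [hG, prod_ofReal_exp, ENNReal.one_le_ofReal, Real.one_le_exp_iff]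
    rw [Finset.sum_add_distrib, hK, ← Finset.mul_sum]
    simp only [Finset.sum_const, Finset.card_univ, Fintype.card_fin, nsmul_eq_mul]
    have := mul_le_mul_of_nonneg_left hω hl0
    linarith
  · rw [jointLaw, lintegral_prod_rows _ _ hGm, ENNReal.ofReal_pow (by have := eta_nonneg; positivity)]
    exact pow_le_pow_left' hrow n

/-- The right side is the tangent at G of the concave function S ↦ S^λ, which is at least 1 for S ≥
1. It replaces conditional Jensen: when G bounds the conditional mean of S, averaging the tangent
gives at most G^λ, and no conditional expectations are needed. -/
theorem one_le_tangent_rpow {lam S G : ℝ} (h0 : 0 ≤ lam) (h1 : lam ≤ 1) (hS : 1 ≤ S)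
    (hG : 0 < G) : 1 ≤ lam * G ^ (lam - 1) * S + (1 - lam) * G ^ lam := by
  have h := Real.geom_mean_le_arith_mean2_weighted h0 (by linarith : 0 ≤ 1 - lam)
    (by linarith : 0 ≤ S) hG.le (by ring)
  have hSl : 1 ≤ S ^ lam := Real.one_le_rpow hS h0
  have hp : 0 < G ^ (lam - 1) := Real.rpow_pos_of_pos hG _
  have e1 : G ^ (1 - lam) * G ^ (lam - 1) = 1 := by
    rw [← Real.rpow_add hG]; simp
  have e2 : G * G ^ (lam - 1) = G ^ lam := by
    rw [Real.rpow_sub_one hG.ne']; field_simp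
  calc 1 ≤ S ^ lam := hSl
    _ = S ^ lam * G ^ (1 - lam) * G ^ (lam - 1) := by rw [mul_assoc, e1, mul_one]
    _ ≤ (lam * S + (1 - lam) * G) * G ^ (lam - 1) := by gcongr
    _ = lam * G ^ (lam - 1) * S + (1 - lam) * (G * G ^ (lam - 1)) := by ring
    _ = _ := by rw [e2]

/-- Gallager's bound for one set D. Given x, y and e, each rival's term averages over z to at most a
constant times the exponential of a statistic free of z. The λ-th power therefore applies to the
number of rivals and the constant, and `ψ` bounds the one-row moment that remains. -/
theorem jointLaw_decoding_le {n L M d l : ℕ} {P σ α : ℝ} (hL : 2 ≤ L) (hd : 1 ≤ d) (hP : 0 < P)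
    (hσ : 0 < σ) (hl0 : l ≠ 0) (hαl : α = (l : ℝ) / L) (hM : 0 < M)
    (f : Fin L → Fin M) {D : Finset (Fin L)} (hD : D.card = l) (t : ℝ) {lam : ℝ}
    (hlam0 : 0 ≤ lam) (hlam1 : lam ≤ 1) {F ψ : ℝ} (hψ0 : 0 ≤ ψ)
    (hF : F = Real.exp (phi (d * l)) * (1 + eta * (1 + α * P / σ ^ 2) / (d * l)))
    (hψ : ∫⁻ e, ∫⁻ y, ∫⁻ x, ENNReal.ofReal (Real.exp (lam *
        ((e + α * (x + y)) ^ 2 / (2 * (σ ^ 2 + α ^ 2 * P)) -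
          (e + x) ^ 2 / (2 * (σ ^ 2 + α * P)))))
        ∂binLaw (Real.sqrt (P / (d * L))) (d * l) ∂binLaw (Real.sqrt (P / (d * L))) (d * (L - l))
        ∂normalLaw (σ ^ 2) ≤ ENNReal.ofReal ψ) :
    jointLaw n L M d P σ {ω | ∃ f' ∈ rivals D f, ∑ i, (
        (ω.2 i + ∑ p ∈ signIndices d D f, ω.1 i p - ∑ p ∈ signIndices d D f', ω.1 i p) ^ 2
          / (2 * σ ^ 2) -
        (ω.2 i + α * (∑ p ∈ signIndices d D f, ω.1 i p + ∑ p ∈ signIndices d Dᶜ f, ω.1 i p)) ^ 2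
          / (2 * (σ ^ 2 + α ^ 2 * P))) ≤ n * t} ≤
      ENNReal.ofReal (((M : ℝ) ^ l * Real.exp (n * t) *
        (F / Real.sqrt (1 + α * P / σ ^ 2)) ^ n) ^ lam * ψ ^ n) := by
  set s := σ ^ 2 with hs
  have hs0 : 0 < s := by positivity
  set B := s + α ^ 2 * P with hB
  have hd' : (0 : ℝ) < d := by exact_mod_cast hd
  have hL' : (0 : ℝ) < L := by exact_mod_cast (by omega : 0 < L)
  have hl' : (0 : ℝ) < l := by positivity
  have hM' : (0 : ℝ) < M := by exact_mod_cast hM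
  have hα0 : 0 < α := by rw [hαl]; positivity
  set a := Real.sqrt (P / (d * L)) with ha
  have ha0 : 0 < a := by positivity
  have hVa : ((d * l : ℕ) : ℝ) * a ^ 2 = α * P := by rw [ha, sqrt_div_sq hP hd hL, hαl]
  set A := s + α * P with hA
  set μr := (Measure.pi fun _ : Col L M × Fin d => signLaw a) with hμr
  have heta := eta_nonneg
  set κ := F / Real.sqrt (1 + α * P / s) with hκ
  have hκ0 : 0 < κ := by rw [hκ, hF]; positivity
  set E : ℝ → ℝ → ℝ → ℝ := fun x y e =>
    (e + α * (x + y)) ^ 2 / (2 * B) - (e + x) ^ 2 / (2 * A) with hE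
  set h : ℝ → ℝ → ℝ → ℝ → ℝ := fun x y z e =>
    (e + α * (x + y)) ^ 2 / (2 * B) - (e + x - z) ^ 2 / (2 * s) with hh
  set Φ := ∫⁻ e, ∫⁻ y, ∫⁻ x, ENNReal.ofReal (Real.exp (lam * E x y e))
    ∂binLaw a (d * l) ∂binLaw a (d * (L - l)) ∂normalLaw s with hΦ
  set X : (Col L M × Fin d → ℝ) → ℝ := fun r => ∑ p ∈ signIndices d D f, r p with hX
  set Y : (Col L M × Fin d → ℝ) → ℝ := fun r => ∑ p ∈ signIndices d Dᶜ f, r p with hY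
  set Z : (Fin L → Fin M) → (Col L M × Fin d → ℝ) → ℝ := fun f' r =>
    ∑ p ∈ signIndices d D f', r p with hZ
  have hXm : Measurable X := by rw [hX]; fun_prop
  have hYm : Measurable Y := by rw [hY]; fun_prop
  have hZm : ∀ f', Measurable (Z f') := by intro f'; simp only [hZ]; fun_prop
  -- `G₁` and `G₂` are the one-row factors of the two terms of the tangent. In `G₁`, averaging over
  -- z turns h into E at the cost κ, so (λ - 1)E + h becomes λE, the exponent in `G₂`.
  set G₁ : (Fin L → Fin M) → (Col L M × Fin d → ℝ) → ℝ → ℝ≥0∞ := fun f' r e =>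
    ENNReal.ofReal (Real.exp ((lam - 1) * E (X r) (Y r) e + h (X r) (Y r) (Z f' r) e)) with hG₁
  set G₂ : (Col L M × Fin d → ℝ) → ℝ → ℝ≥0∞ := fun r e =>
    ENNReal.ofReal (Real.exp (lam * E (X r) (Y r) e)) with hG₂
  have hG₁m : ∀ f', Measurable (Function.uncurry (G₁ f')) := by
    intro f'
    have := hZm f'
    simp only [hG₁, hE, hh, Function.uncurry_def]
    fun_prop
  have hG₂m : Measurable (Function.uncurry G₂) := by
    simp only [hG₂, hE, Function.uncurry_def]
    fun_prop
  have hcard₁ : (signIndices d D f).card = d * l := by rw [card_signIndices, hD]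
  have hcard₂ : (signIndices d Dᶜ f).card = d * (L - l) := by
    rw [card_signIndices, Finset.card_compl, hD, Fintype.card_fin]
  have hXY : Disjoint (signIndices d D f) (signIndices d Dᶜ f) :=
    disjoint_signIndices_of_disjoint disjoint_compl_right _ _
  have hrow₂ : ∫⁻ e, ∫⁻ r, G₂ r e ∂μr ∂normalLaw s = Φ := by
    rw [hΦ]
    refine lintegral_congr fun e => ?_
    rw [← hcard₁, ← hcard₂]
    refine lintegral_signs_two a hXY (F := fun x y => ENNReal.ofReal (Real.exp (lam * E x y e))) ?_
    simp only [hE, Function.uncurry_def]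
    fun_prop
  have hrow₁ : ∀ f' ∈ rivals D f, ∫⁻ e, ∫⁻ r, G₁ f' r e ∂μr ∂normalLaw s ≤
      ENNReal.ofReal κ * Φ := by
    intro f' hf'
    simp only [rivals, Finset.mem_filter, Finset.mem_univ, true_and] at hf'
    have hcard₃ : (signIndices d D f').card = d * l := by rw [card_signIndices, hD]
    have hXZ : Disjoint (signIndices d D f) (signIndices d D f') :=
      disjoint_signIndices_of_ne hf'.1
    have hYZ : Disjoint (signIndices d Dᶜ f) (signIndices d D f') :=
      disjoint_signIndices_of_disjoint disjoint_compl_left _ _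
    have h1 : ∀ e, ∫⁻ r, G₁ f' r e ∂μr = ∫⁻ y, ∫⁻ x, ∫⁻ z,
        ENNReal.ofReal (Real.exp ((lam - 1) * E x y e + h x y z e))
        ∂binLaw a (d * l) ∂binLaw a (d * l) ∂binLaw a (d * (L - l)) := by
      intro e
      have := lintegral_signs_three a hXY hXZ hYZ (F := fun x y z =>
        ENNReal.ofReal (Real.exp ((lam - 1) * E x y e + h x y z e)))
        (by simp only [hE, hh]; fun_prop)
      rw [hcard₁, hcard₂, hcard₃] at this
      exact this
    have h2 : ∀ e y x, ∫⁻ z, ENNReal.ofReal (Real.exp ((lam - 1) * E x y e + h x y z e))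
        ∂binLaw a (d * l) ≤ ENNReal.ofReal κ * ENNReal.ofReal (Real.exp (lam * E x y e)) := by
      intro e y x
      have h3 := lintegral_exp_neg_sq_binLaw_le ha0 (m := d * l)
        (Nat.mul_ne_zero (by omega) hl0) hs0 (e + x)
      rw [hVa] at h3
      have e1 : ∀ z, ENNReal.ofReal (Real.exp ((lam - 1) * E x y e + h x y z e)) =
          ENNReal.ofReal (Real.exp ((lam - 1) * E x y e + (e + α * (x + y)) ^ 2 / (2 * B))) *
          ENNReal.ofReal (Real.exp (-((e + x - z) ^ 2 / (2 * s)))) := by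
        intro z
        rw [← ENNReal.ofReal_mul (Real.exp_pos _).le, ← Real.exp_add, hh]
        congr 2; ring
      simp_rw [e1]
      rw [lintegral_const_mul _ (by fun_prop)]
      refine (mul_le_mul_right h3 _).trans (le_of_eq ?_)
      rw [mul_left_comm]
      congr 1
      · rw [hκ, hF]; push_cast; rfl
      · rw [← ENNReal.ofReal_mul (Real.exp_pos _).le, ← Real.exp_add, hE]
        congr 2
        simp only
        rw [← hA]
        ring
    have hm : Measurable fun q : ℝ × ℝ × ℝ =>
        ENNReal.ofReal (Real.exp (lam * E q.1 q.2.1 q.2.2)) := by simp only [hE]; fun_prop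
    rw [hΦ, ← lintegral_const_mul _ (by simp only [hE]; fun_prop)]
    refine lintegral_mono fun e => ?_
    simp only
    rw [h1, ← lintegral_const_mul _ (by simp only [hE]; fun_prop)]
    refine lintegral_mono fun y => ?_
    simp only
    rw [← lintegral_const_mul _ (by simp only [hE]; fun_prop)]
    exact lintegral_mono fun x => h2 e y x
  -- `G₀` times exp(ΣE) bounds the mean of the sum over rivals given x, y and e; this is the point
  -- of tangency.
  set G₀ : ℝ := (M : ℝ) ^ l * Real.exp (n * t) * κ ^ n with hG₀
  have hG₀0 : 0 < G₀ := by positivity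
  set H : Sample n L M d → ℝ≥0∞ := fun ω =>
    (∑ f' ∈ rivals D f, ENNReal.ofReal (lam * G₀ ^ (lam - 1) * Real.exp (n * t)) *
      ∏ i, G₁ f' (ω.1 i) (ω.2 i)) +
    ENNReal.ofReal ((1 - lam) * G₀ ^ lam) * ∏ i, G₂ (ω.1 i) (ω.2 i) with hH
  have hm₁ : ∀ f', Measurable fun ω : Sample n L M d => ∏ i, G₁ f' (ω.1 i) (ω.2 i) := fun f' =>
    Finset.measurable_prod _ fun i _ =>
      (hG₁m f').comp (f := fun ω : Sample n L M d => (ω.1 i, ω.2 i)) (by fun_prop)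
  have hm₂ : Measurable fun ω : Sample n L M d => ∏ i, G₂ (ω.1 i) (ω.2 i) :=
    Finset.measurable_prod _ fun i _ =>
      hG₂m.comp (f := fun ω : Sample n L M d => (ω.1 i, ω.2 i)) (by fun_prop)
  refine (measure_le_lintegral_of_one_le _ (H := H) ?_ ?_).trans ?_
  · have := hm₁
    fun_prop
  · rintro ω ⟨f', hf', hω⟩
    set SE := ∑ i, E (X (ω.1 i)) (Y (ω.1 i)) (ω.2 i) with hSE
    have hprod₁ : ∀ f', ∏ i, G₁ f' (ω.1 i) (ω.2 i) = ENNReal.ofReal (Real.exp ((lam - 1) * SE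
        + ∑ i, h (X (ω.1 i)) (Y (ω.1 i)) (Z f' (ω.1 i)) (ω.2 i))) := by
      intro f'
      simp only [hG₁]
      rw [prod_ofReal_exp, Finset.sum_add_distrib, Finset.mul_sum]
    have hprod₂ : ∏ i, G₂ (ω.1 i) (ω.2 i) = ENNReal.ofReal (Real.exp (lam * SE)) := by
      simp only [hG₂]
      rw [prod_ofReal_exp, Finset.mul_sum]
    have hS : 1 ≤ ∑ f' ∈ rivals D f, Real.exp (n * t +
        ∑ i, h (X (ω.1 i)) (Y (ω.1 i)) (Z f' (ω.1 i)) (ω.2 i)) := by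
      refine le_trans ?_ (Finset.single_le_sum (f := fun f' => Real.exp (n * t +
        ∑ i, h (X (ω.1 i)) (Y (ω.1 i)) (Z f' (ω.1 i)) (ω.2 i)))
        (fun _ _ => (Real.exp_pos _).le) hf')
      rw [Real.one_le_exp_iff]
      have : ∑ i, h (X (ω.1 i)) (Y (ω.1 i)) (Z f' (ω.1 i)) (ω.2 i) = -∑ i, (
        (ω.2 i + ∑ p ∈ signIndices d D f, ω.1 i p - ∑ p ∈ signIndices d D f', ω.1 i p) ^ 2
          / (2 * s) -
        (ω.2 i + α * (∑ p ∈ signIndices d D f, ω.1 i p + ∑ p ∈ signIndices d Dᶜ f, ω.1 i p)) ^ 2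
          / (2 * B)) := by
        rw [← Finset.sum_neg_distrib]
        refine Finset.sum_congr rfl fun i _ => ?_
        simp only [hh, hX, hY, hZ]
        ring
      rw [this]
      linarith
    have key := one_le_tangent_rpow hlam0 hlam1 hS (mul_pos hG₀0 (Real.exp_pos SE))
    simp only [hH]
    simp_rw [hprod₁, hprod₂]
    have hG₀l : 0 < G₀ ^ (lam - 1) := Real.rpow_pos_of_pos hG₀0 _
    have hG₀l' : 0 < G₀ ^ lam := Real.rpow_pos_of_pos hG₀0 _
    have h1l : 0 ≤ 1 - lam := by linarith
    rw [← Finset.mul_sum, ← ENNReal.ofReal_sum_of_nonneg (fun _ _ => (Real.exp_pos _).le),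
      ← ENNReal.ofReal_mul (by positivity), ← ENNReal.ofReal_mul (by positivity),
      ← ENNReal.ofReal_add (mul_nonneg (by positivity)
        (Finset.sum_nonneg fun _ _ => (Real.exp_pos _).le)) (by positivity),
      ENNReal.one_le_ofReal]
    refine key.trans (le_of_eq ?_)
    rw [Real.mul_rpow hG₀0.le (Real.exp_pos _).le, Real.mul_rpow hG₀0.le (Real.exp_pos _).le,
      ← Real.exp_mul, ← Real.exp_mul, Finset.mul_sum, Finset.mul_sum, mul_assoc (1 - lam),
      mul_comm SE lam]
    congr 1
    refine Finset.sum_congr rfl fun f' _ => ?_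
    rw [Real.exp_add, Real.exp_add, mul_comm SE (lam - 1)]
    ring
  · have hG₀l : 0 < G₀ ^ (lam - 1) := Real.rpow_pos_of_pos hG₀0 _
    have hG₀l' : 0 < G₀ ^ lam := Real.rpow_pos_of_pos hG₀0 _
    have h1l : 0 ≤ 1 - lam := by linarith
    have hint₁ : ∀ f' ∈ rivals D f, ∫⁻ ω, ∏ i, G₁ f' (ω.1 i) (ω.2 i) ∂jointLaw n L M d P σ ≤
        ENNReal.ofReal (κ ^ n * ψ ^ n) := by
      intro f' hf'
      rw [jointLaw, lintegral_prod_rows _ _ (hG₁m f'), ← mul_pow, ENNReal.ofReal_pow (by positivity),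
        ENNReal.ofReal_mul hκ0.le]
      exact pow_le_pow_left' ((hrow₁ f' hf').trans (mul_le_mul_right hψ _)) n
    have hint₂ : ∫⁻ ω, ∏ i, G₂ (ω.1 i) (ω.2 i) ∂jointLaw n L M d P σ ≤
        ENNReal.ofReal (ψ ^ n) := by
      rw [jointLaw, lintegral_prod_rows _ _ hG₂m, ENNReal.ofReal_pow hψ0]
      exact pow_le_pow_left' (hrow₂.le.trans hψ) n
    simp only [hH]
    rw [lintegral_add_right _ (hm₂.const_mul _), lintegral_const_mul _ hm₂,
      lintegral_finsetSum _ (fun f' _ => (hm₁ f').const_mul _)]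
    simp_rw [lintegral_const_mul _ (hm₁ _)]
    have hcardR : ((rivals D f).card : ℝ) ≤ (M : ℝ) ^ l := by
      rw [← hD]; exact_mod_cast card_rivals_le D f
    calc _ ≤ ∑ f' ∈ rivals D f, ENNReal.ofReal (lam * G₀ ^ (lam - 1) * Real.exp (n * t)) *
            ENNReal.ofReal (κ ^ n * ψ ^ n) +
          ENNReal.ofReal ((1 - lam) * G₀ ^ lam) * ENNReal.ofReal (ψ ^ n) := by
          gcongr with f' hf'
          exact hint₁ f' hf'
      _ = ENNReal.ofReal ((rivals D f).card * (lam * G₀ ^ (lam - 1) * Real.exp (n * t)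
            * (κ ^ n * ψ ^ n)) + (1 - lam) * G₀ ^ lam * ψ ^ n) := by
          rw [Finset.sum_const, nsmul_eq_mul, ENNReal.ofReal_add (by positivity) (by positivity),
            ENNReal.ofReal_mul (p := ((rivals D f).card : ℝ)) (by positivity),
            ENNReal.ofReal_natCast,
            ENNReal.ofReal_mul (p := lam * G₀ ^ (lam - 1) * Real.exp (n * t)) (by positivity),
            ENNReal.ofReal_mul (p := (1 - lam) * G₀ ^ lam) (by positivity)]
      _ ≤ _ := by
          refine ENNReal.ofReal_le_ofReal ?_
          have e2 : (M : ℝ) ^ l * (lam * G₀ ^ (lam - 1) * Real.exp (n * t) * (κ ^ n * ψ ^ n)) =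
              lam * (G₀ ^ lam * ψ ^ n) := by
            rw [Real.rpow_sub_one hG₀0.ne']
            have : (M : ℝ) ^ l * Real.exp (n * t) * κ ^ n / G₀ = 1 := div_self hG₀0.ne'
            calc _ = lam * (G₀ ^ lam * ψ ^ n) *
                  ((M : ℝ) ^ l * Real.exp (n * t) * κ ^ n / G₀) := by ring
              _ = _ := by rw [this, mul_one]
          have e3 : ((rivals D f).card : ℝ) * (lam * G₀ ^ (lam - 1) * Real.exp (n * t)
              * (κ ^ n * ψ ^ n)) ≤
              (M : ℝ) ^ l * (lam * G₀ ^ (lam - 1) * Real.exp (n * t) * (κ ^ n * ψ ^ n)) := by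
            gcongr
          linarith

/-! ### The exponents as functions of the threshold -/

/-- A supremum of affine functions of Δ with slopes in [0, K] is K-Lipschitz. The resulting
continuity of the exponents makes the minimum over t attained. -/
theorem csSup_image_mul_add_le {S : Set ℝ} {g : ℝ → ℝ} {K : ℝ} (hne : S.Nonempty)
    (hS : ∀ x ∈ S, 0 ≤ x ∧ x ≤ K) (hg : ∀ x ∈ S, g x ≤ 0) (Δ Δ' : ℝ) :
    sSup ((fun x => x * Δ + g x) '' S) ≤ sSup ((fun x => x * Δ' + g x) '' S) + K * |Δ - Δ'| := by
  refine csSup_le (hne.image _) ?_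
  rintro _ ⟨x, hx, rfl⟩
  have hb : BddAbove ((fun x => x * Δ' + g x) '' S) := by
    refine ⟨K * |Δ'|, ?_⟩
    rintro _ ⟨y, hy, rfl⟩
    have h1 : y * Δ' ≤ K * |Δ'| :=
      (mul_le_mul_of_nonneg_left (le_abs_self _) (hS y hy).1).trans
        (mul_le_mul_of_nonneg_right (hS y hy).2 (abs_nonneg _))
    have := hg y hy
    simp only
    linarith
  have h := le_csSup hb ⟨x, hx, rfl⟩
  have h1 : x * (Δ - Δ') ≤ K * |Δ - Δ'| :=
    (mul_le_mul_of_nonneg_left (le_abs_self _) (hS x hx).1).trans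
      (mul_le_mul_of_nonneg_right (hS x hx).2 (abs_nonneg _))
  simp only at h ⊢
  linarith

theorem continuous_csSup_image {S : Set ℝ} {g : ℝ → ℝ} {K : ℝ} (hne : S.Nonempty)
    (hS : ∀ x ∈ S, 0 ≤ x ∧ x ≤ K) (hg : ∀ x ∈ S, g x ≤ 0) :
    Continuous fun Δ => sSup ((fun x => x * Δ + g x) '' S) := by
  obtain ⟨x₀, hx₀⟩ := hne
  have hK : 0 ≤ K := (hS x₀ hx₀).1.trans (hS x₀ hx₀).2
  refine (LipschitzWith.of_dist_le_mul (K := K.toNNReal) fun Δ Δ' => ?_).continuous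
  rw [Real.dist_eq, Real.dist_eq, abs_le, Real.coe_toNNReal _ hK]
  have h1 := csSup_image_mul_add_le ⟨x₀, hx₀⟩ hS hg Δ Δ'
  have h2 := csSup_image_mul_add_le ⟨x₀, hx₀⟩ hS hg Δ' Δ
  rw [abs_sub_comm] at h2
  constructor <;> linarith

theorem half_log_one_sub_nonpos {q : ℝ} (hq : 0 ≤ q) {x : ℝ} (hx : 0 < 1 - x ^ 2 * q) :
    1 / 2 * Real.log (1 - x ^ 2 * q) ≤ 0 := by
  have := Real.log_nonpos hx.le (by nlinarith [mul_nonneg (sq_nonneg x) hq])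
  linarith

theorem continuous_expD {q : ℝ} (hq : 0 < q) : Continuous fun Δ => expD Δ q := by
  refine continuous_csSup_image (S := {x : ℝ | 0 ≤ x ∧ 0 < 1 - x ^ 2 * q})
    (g := fun x => 1 / 2 * Real.log (1 - x ^ 2 * q)) (K := 1 + 1 / q) ⟨0, by simp⟩ ?_
    fun x hx => half_log_one_sub_nonpos hq.le hx.2
  rintro x ⟨h0, h1⟩
  refine ⟨h0, ?_⟩
  have h2 : x ^ 2 ≤ 1 / q := by rw [le_div_iff₀ hq]; linarith
  nlinarith [sq_nonneg (x - 1), sq_nonneg x]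

theorem continuous_expD₁ {q : ℝ} (hq : 0 ≤ q) : Continuous fun Δ => expD₁ Δ q :=
  continuous_csSup_image (S := {x : ℝ | (0 ≤ x ∧ x ≤ 1) ∧ 0 < 1 - x ^ 2 * q})
    (g := fun x => 1 / 2 * Real.log (1 - x ^ 2 * q)) (K := 1) ⟨0, by simp⟩
    (fun x hx => hx.1) fun x hx => half_log_one_sub_nonpos hq hx.2

theorem exists_isLeast_errBin (n L d l : ℕ) {v α : ℝ} (α₀ R : ℝ) (hv : 0 < v) (hα : 0 < α)
    (hα1 : α ≤ 1) (hR : α * R ≤ partialCapacity v α) :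
    ∃ t ∈ Set.Icc 0 (partialCapacity v α - α * R),
      IsLeast ((fun t : ℝ => errBin n L d l v α₀ R α t) ''
        Set.Icc 0 (partialCapacity v α - α * R)) (errBin n L d l v α₀ R α t) := by
  have hq : 0 < α ^ 2 * v / (1 + α ^ 2 * v) := by positivity
  have hq₁ : 0 ≤ α * (1 - α) * v / (1 + α * v) := by
    have : 0 ≤ 1 - α := by linarith
    positivity
  have hc := continuous_expD hq
  have hc₁ := continuous_expD₁ hq₁
  have hcont : Continuous fun t : ℝ => errBin n L d l v α₀ R α t := by
    unfold errBin
    have h1 : Continuous fun t : ℝ => expD₁ (partialCapacity v α - α * R - t)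
      (α * (1 - α) * v / (1 + α * v)) := hc₁.comp (by fun_prop)
    fun_prop
  obtain ⟨t, ht, hmin⟩ := isCompact_Icc.exists_isMinOn
    (Set.nonempty_Icc.2 (sub_nonneg.2 hR)) hcont.continuousOn
  refine ⟨t, ht, ⟨t, ht, rfl⟩, ?_⟩
  rintro _ ⟨t', ht', rfl⟩
  exact hmin ht'

/-- Passes from a bound for every λ to one with the supremum, without needing a maximizing λ: taking
logarithms, each bound limits g(x) by one fixed number. -/
theorem le_ofReal_exp_csSup {p : ℝ≥0∞} {n : ℕ} (hn : n ≠ 0) {S : Set ℝ} {g : ℝ → ℝ} {ι : ℝ}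
    (hne : S.Nonempty) (h : ∀ x ∈ S, p ≤ ENNReal.ofReal (Real.exp (-(n * (g x - ι))))) :
    p ≤ ENNReal.ofReal (Real.exp (-(n * (sSup (g '' S) - ι)))) := by
  rcases eq_or_ne p 0 with rfl | hp
  · exact zero_le
  obtain ⟨x₀, hx₀⟩ := hne
  have hpt : p ≠ ⊤ := ne_top_of_le_ne_top ENNReal.ofReal_ne_top (h x₀ hx₀)
  have hpp : 0 < p.toReal := ENNReal.toReal_pos hp hpt
  have hn' : (0 : ℝ) < n := by positivity
  have hle : sSup (g '' S) ≤ ι - Real.log p.toReal / n := by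
    refine csSup_le ⟨_, x₀, hx₀, rfl⟩ ?_
    rintro _ ⟨x, hx, rfl⟩
    have h1 := ENNReal.toReal_le_of_le_ofReal (Real.exp_pos _).le (h x hx)
    rw [← Real.log_le_iff_le_exp hpp] at h1
    have h2 : Real.log p.toReal / n ≤ -(g x - ι) := by
      rw [div_le_iff₀ hn']; linarith
    linarith
  rw [ENNReal.le_ofReal_iff_toReal_le hpt (Real.exp_pos _).le, ← Real.log_le_iff_le_exp hpp]
  have : Real.log p.toReal / n ≤ -(sSup (g '' S) - ι) := by linarith
  rw [div_le_iff₀ hn'] at this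
  linarith

/-! ### The correction terms -/

theorem le_maxOver {L : ℕ} {p : ℕ → Prop} {f : ℕ → ℝ} {k : ℕ} (hk : k ≤ L) (hp : p k) :
    f k ≤ maxOver L p f := by
  classical
  have hmem : k ∈ (Finset.range (L + 1)).filter p := by simp [hp]; omega
  rw [maxOver, dif_pos ⟨k, by convert hmem⟩]
  exact Finset.le_sup' f (by convert hmem)

theorem maxOver_le {L : ℕ} {p : ℕ → Prop} {f : ℕ → ℝ} {C : ℝ} (hC : 1 ≤ C)
    (h : ∀ k ≤ L, p k → f k ≤ C) : maxOver L p f ≤ C := by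
  rw [maxOver]
  split_ifs with hne
  · refine Finset.sup'_le hne f fun k hk => ?_
    simp only [Finset.mem_filter, Finset.mem_range] at hk
    exact h k (by omega) hk.2
  · exact hC

theorem one_le_maxOver {L : ℕ} {p : ℕ → Prop} {f : ℕ → ℝ} (h : ∀ k ≤ L, p k → 1 ≤ f k) :
    1 ≤ maxOver L p f := by
  classical
  by_cases hne : ((Finset.range (L + 1)).filter p).Nonempty
  · obtain ⟨k, hk⟩ := hne
    simp only [Finset.mem_filter, Finset.mem_range] at hk
    exact (h k (by omega) hk.2).trans (le_maxOver (by omega) hk.2)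
  · rw [maxOver, dif_neg (by convert hne)]

theorem one_le_exp_phi (k : ℕ) : 1 ≤ Real.exp (phi k) := Real.one_le_exp (phi_nonneg k)

theorem one_le_one_add_eta_div {c : ℝ} (hc : 0 ≤ c) : 1 ≤ 1 + eta / c := by
  have := div_nonneg eta_nonneg hc
  linarith

theorem one_le_iota₃ (L d : ℕ) {v : ℝ} (hv : 0 ≤ v) (α₀ : ℝ) : 1 ≤ 1 + iota₃ L d v α₀ := by
  rw [iota₃, add_sub_cancel]
  refine one_le_maxOver fun k _ _ => one_le_mul_of_one_le_of_one_le (one_le_exp_phi _) ?_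
  have : 0 ≤ eta * (1 + v) / (d * k) := by have := eta_nonneg; positivity
  linarith

theorem one_le_iota₄_term {L d k : ℕ} (hk : k ≤ L) :
    1 ≤ Real.exp (phi (d * k) + phi (d * (L - k))) * (1 + eta / (d * k)) *
      (1 + eta / (d * ((L : ℝ) - k))) := by
  have hk' : (k : ℝ) ≤ L := by exact_mod_cast hk
  refine one_le_mul_of_one_le_of_one_le (one_le_mul_of_one_le_of_one_le ?_ ?_) ?_
  · exact Real.one_le_exp (add_nonneg (phi_nonneg _) (phi_nonneg _))
  · exact one_le_one_add_eta_div (by positivity)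
  · exact one_le_one_add_eta_div (mul_nonneg (by positivity) (by linarith))

theorem one_div_sqrt_lt_one {d L : ℕ} (hd : 1 ≤ d) (hL : 2 ≤ L) :
    1 / Real.sqrt (d * L) < 1 := by
  have h2 : (2 : ℝ) ≤ d * L := by exact_mod_cast Nat.le_mul_of_pos_left L hd |>.trans' hL
  rw [div_lt_one (by positivity), Real.lt_sqrt (by norm_num)]
  linarith

theorem one_le_one_div_sqrt_one_sub {d L : ℕ} (hd : 1 ≤ d) (hL : 2 ≤ L) :
    1 ≤ 1 / Real.sqrt (1 - 1 / Real.sqrt (d * L)) := by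
  have h1 := one_div_sqrt_lt_one hd hL
  have h0 : 0 ≤ 1 / Real.sqrt (d * L) := by positivity
  have h2 : 0 < Real.sqrt (1 - 1 / Real.sqrt (d * L)) := Real.sqrt_pos.2 (by linarith)
  rw [le_div_iff₀ h2, one_mul]
  exact Real.sqrt_le_one.2 (by linarith)

/-- The common columns were replaced without loss, so only the factor for k is needed. The other
factors in ι₄ and ι₅ are at least 1, and the two ranges of k cover all k < L. -/
theorem exp_phi_mul_le_of_lt {L d k : ℕ} {α₀ : ℝ} (hd : 1 ≤ d) (hL : 2 ≤ L) (hk : k < L)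
    (hα : α₀ * L ≤ k) :
    Real.exp (phi (d * k)) * (1 + eta / (d * k)) ≤ 1 + max (iota₄ L d α₀) (iota₅ L d) := by
  have hk1 : (k : ℝ) ≤ (L : ℝ) - 1 := by
    have : (k : ℝ) + 1 ≤ L := by exact_mod_cast hk
    linarith
  have hb : 0 ≤ Real.exp (phi (d * k)) * (1 + eta / (d * k)) := by
    have := one_le_one_add_eta_div (c := (d : ℝ) * k) (by positivity)
    have := Real.exp_pos (phi (d * k))
    positivity
  rcases le_total (k : ℝ) (L - Real.sqrt (L / d)) with h | h
  · have h4 : Real.exp (phi (d * k) + phi (d * (L - k))) * (1 + eta / (d * k)) *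
        (1 + eta / (d * ((L : ℝ) - k))) ≤ 1 + iota₄ L d α₀ := by
      rw [iota₄, add_sub_cancel]
      exact le_maxOver (f := fun k => Real.exp (phi (d * k) + phi (d * (L - k))) *
        (1 + eta / (d * k)) * (1 + eta / (d * ((L : ℝ) - k)))) hk.le ⟨hα, h⟩
    have h5 : 1 ≤ Real.exp (phi (d * (L - k))) * (1 + eta / (d * ((L : ℝ) - k))) :=
      one_le_mul_of_one_le_of_one_le (one_le_exp_phi _)
        (one_le_one_add_eta_div (mul_nonneg (by positivity) (by linarith)))
    calc _ ≤ Real.exp (phi (d * k)) * (1 + eta / (d * k)) *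
          (Real.exp (phi (d * (L - k))) * (1 + eta / (d * ((L : ℝ) - k)))) :=
          le_mul_of_one_le_right hb h5
      _ = Real.exp (phi (d * k) + phi (d * (L - k))) * (1 + eta / (d * k)) *
        (1 + eta / (d * ((L : ℝ) - k))) := by rw [Real.exp_add]; ring
      _ ≤ 1 + iota₄ L d α₀ := h4
      _ ≤ _ := by linarith [le_max_left (iota₄ L d α₀) (iota₅ L d)]
  · have h5 : Real.exp (phi (d * k)) / Real.sqrt (1 - 1 / Real.sqrt (d * L)) *
      (1 + eta / (d * k)) ≤ 1 + iota₅ L d := by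
      rw [iota₅, add_sub_cancel]
      exact le_maxOver (f := fun k => Real.exp (phi (d * k)) /
        Real.sqrt (1 - 1 / Real.sqrt (d * L)) * (1 + eta / (d * k))) hk.le ⟨h, hk1⟩
    calc _ ≤ Real.exp (phi (d * k)) * (1 + eta / (d * k)) *
          (1 / Real.sqrt (1 - 1 / Real.sqrt (d * L))) :=
          le_mul_of_one_le_right hb (one_le_one_div_sqrt_one_sub hd hL)
      _ = _ := by ring
      _ ≤ _ := h5
      _ ≤ _ := by linarith [le_max_right (iota₄ L d α₀) (iota₅ L d)]

theorem one_le_one_add_max {L d : ℕ} (α₀ : ℝ) :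
    1 ≤ 1 + max (iota₄ L d α₀) (iota₅ L d) := by
  have h4 : 1 ≤ 1 + iota₄ L d α₀ := by
    rw [iota₄, add_sub_cancel]
    exact one_le_maxOver fun k hk _ => one_le_iota₄_term hk
  linarith [le_max_left (iota₄ L d α₀) (iota₅ L d)]

/-! ### Asymptotics of the correction terms -/

/-- Half of the linear term absorbs the logarithm through a tangent line; then -(c/2)k + C ≤
C²/(2ck) by completing the square. -/
theorem exists_neg_linear_add_log_le {c : ℝ} (hc : 0 < c) (B : ℝ) :
    ∃ K : ℝ, 0 ≤ K ∧ ∀ k : ℝ, 0 < k → -(c * k) + Real.log k + B ≤ K / k := by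
  set C := -Real.log (c / 2) - 1 + B with hC
  refine ⟨C ^ 2 / (2 * c), by positivity, fun k hk => ?_⟩
  have h1 := Real.log_le_sub_one_of_pos (x := c / 2 * k) (by positivity)
  rw [Real.log_mul (by positivity) hk.ne'] at h1
  have h2 : -(c * k) + Real.log k + B ≤ -(c / 2 * k) + C := by rw [hC]; linarith
  refine h2.trans ?_
  rw [le_div_iff₀ hk, le_div_iff₀ (by positivity)]
  nlinarith [sq_nonneg (C - c * k)]

theorem exists_phi_le : ∃ K : ℝ, 0 ≤ K ∧ ∀ k : ℕ, k ≠ 0 → phi k ≤ K / k := by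
  have hl2 : 0 < Real.log 2 - 1 / 2 := by have := Real.log_two_gt_d9; linarith
  obtain ⟨K₁, hK₁, h₁⟩ := exists_neg_linear_add_log_le (c := 4 * (1 / 4) ^ 4 / 3) (by norm_num)
    (-Real.log 2)
  obtain ⟨K₂, hK₂, h₂⟩ := exists_neg_linear_add_log_le hl2 (1 / 2 * Real.log (Real.pi / 2))
  set K₀ : ℝ := 3 / 16 * cZeta (1 / 4) ^ 2 + 1 / 12 with hK₀
  have hK₀p : 0 ≤ K₀ := by positivity
  refine ⟨K₀ + (K₁ + 1 / 12) + K₂, by positivity, fun k hk => ?_⟩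
  have hk0 : (0 : ℝ) < k := by positivity
  have hk1 : (1 : ℝ) ≤ k := by exact_mod_cast Nat.one_le_iff_ne_zero.2 hk
  -- As φ is an infimum over ζ, any fixed ζ gives an upper bound; 1/4 is a convenient choice.
  refine (phi_le (by norm_num : (0 : ℝ) < 1 / 4) (by norm_num) k).trans ?_
  have hs : ∀ x y : ℝ, x ≤ y → x / k ≤ y / k := fun x y h => div_le_div_of_nonneg_right h hk0.le
  refine max_le (max_le ?_ ?_) ?_
  · rw [← hK₀, mul_one_div]
    exact hs _ _ (by linarith)
  · have h := h₁ k hk0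
    rw [Real.log_div hk0.ne' two_ne_zero]
    calc _ ≤ K₁ / k + 1 / (12 * k) := by linarith
      _ = (K₁ + 1 / 12) / k := by field_simp
      _ ≤ _ := hs _ _ (by linarith)
  · have h := h₂ k hk0
    have hpi := Real.pi_pos
    rw [show Real.pi * k / 2 = Real.pi / 2 * k by ring, Real.log_mul (by positivity) hk0.ne']
    have hlog : 0 ≤ Real.log k := Real.log_natCast_nonneg k
    calc _ ≤ K₂ / k := by linarith
      _ ≤ _ := hs _ _ (by linarith)

theorem exists_abs_iota₂_le : ∃ K : ℝ, ∀ d L : ℕ, 1 ≤ d → 2 ≤ L →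
    |iota₂ L d| ≤ K / (d * L) := by
  obtain ⟨K, hK, h⟩ := exists_phi_le
  have heta := eta_nonneg
  refine ⟨K + 2 * eta, fun d L hd hL => ?_⟩
  have hd' : (0 : ℝ) < d := by exact_mod_cast hd
  have hL' : (0 : ℝ) < L := by exact_mod_cast (by omega : 0 < L)
  have h1 := h (d * L) (Nat.mul_ne_zero (by omega) (by omega))
  have h0 := phi_nonneg (d * L)
  have hx : 0 ≤ 2 * eta / (d * L) := by positivity
  have h2 := Real.log_nonneg (by linarith : 1 ≤ 1 + 2 * eta / (d * L : ℝ))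
  have h3 := Real.log_le_sub_one_of_pos (by linarith : 0 < 1 + 2 * eta / (d * L : ℝ))
  rw [iota₂, abs_of_nonneg (add_nonneg h0 h2), add_div]
  push_cast at h1
  linarith

theorem sqrt_le_self_of_one_le {x : ℝ} (hx : 1 ≤ x) : Real.sqrt x ≤ x :=
  Real.sqrt_le_iff.2 ⟨by linarith, by nlinarith⟩

theorem exists_iota₃_le {v α₀ : ℝ} (hv : 0 < v) (hα : 0 < α₀) :
    ∃ K : ℝ, 0 ≤ K ∧ ∀ d L : ℕ, 1 ≤ d → 2 ≤ L →
      1 + iota₃ L d v α₀ ≤ Real.exp (K / Real.sqrt (d * L)) := by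
  obtain ⟨K, hK, h⟩ := exists_phi_le
  have heta := eta_nonneg
  refine ⟨(K + eta * (1 + v)) / α₀, by positivity, fun d L hd hL => ?_⟩
  have hd' : (1 : ℝ) ≤ d := by exact_mod_cast hd
  have hL' : (2 : ℝ) ≤ L := by exact_mod_cast hL
  have hdL : (1 : ℝ) ≤ d * L := by nlinarith
  have hs : Real.sqrt (d * L) ≤ d * L := sqrt_le_self_of_one_le hdL
  have hs0 : 0 < Real.sqrt (d * L) := by positivity
  rw [iota₃, add_sub_cancel]
  refine maxOver_le (Real.one_le_exp (by positivity)) fun k _ hk => ?_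
  have hk0 : (0 : ℝ) < k := lt_of_lt_of_le (by positivity) hk
  have hkn : k ≠ 0 := by rintro rfl; simp at hk0
  have h1 := h (d * k) (Nat.mul_ne_zero (by omega) hkn)
  push_cast at h1
  have hx : 0 ≤ eta * (1 + v) / (d * k) := by positivity
  calc _ ≤ Real.exp (K / (d * k)) * Real.exp (eta * (1 + v) / (d * k)) := by
        gcongr
        linarith [Real.add_one_le_exp (eta * (1 + v) / (d * k : ℝ))]
    _ = Real.exp ((K + eta * (1 + v)) / (d * k)) := by rw [← Real.exp_add, add_div]
    _ ≤ _ := by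
      refine Real.exp_le_exp.2 ?_
      rw [div_div]
      refine div_le_div_of_nonneg_left (by positivity) (by positivity) ?_
      nlinarith

theorem exists_iota₄_le {α₀ : ℝ} (hα : 0 < α₀) :
    ∃ K : ℝ, 0 ≤ K ∧ ∀ d L : ℕ, 1 ≤ d → 2 ≤ L →
      1 + iota₄ L d α₀ ≤ Real.exp (K / Real.sqrt (d * L)) := by
  obtain ⟨K, hK, h⟩ := exists_phi_le
  have heta := eta_nonneg
  refine ⟨(K + eta) / α₀ + (K + eta), by positivity, fun d L hd hL => ?_⟩
  have hd' : (1 : ℝ) ≤ d := by exact_mod_cast hd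
  have hL' : (2 : ℝ) ≤ L := by exact_mod_cast hL
  have hdL : (1 : ℝ) ≤ d * L := by nlinarith
  have hs : Real.sqrt (d * L) ≤ d * L := sqrt_le_self_of_one_le hdL
  have hs0 : 0 < Real.sqrt (d * L) := by positivity
  rw [iota₄, add_sub_cancel]
  refine maxOver_le (Real.one_le_exp (by positivity)) fun k hkL hk => ?_
  have hk0 : (0 : ℝ) < k := lt_of_lt_of_le (by positivity) hk.1
  have hkn : k ≠ 0 := by rintro rfl; simp at hk0
  have hLd : 0 < Real.sqrt (L / d) := by positivity
  have hj0 : (0 : ℝ) < (L : ℝ) - k := by linarith [hk.2]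
  have hjn : L - k ≠ 0 := by
    intro h0
    have : (L : ℝ) ≤ k := by exact_mod_cast Nat.sub_eq_zero_iff_le.1 h0
    linarith
  have h1 := h (d * k) (Nat.mul_ne_zero (by omega) hkn)
  have h2 := h (d * (L - k)) (Nat.mul_ne_zero (by omega) hjn)
  rw [Nat.cast_mul, Nat.cast_sub hkL] at h2
  rw [Nat.cast_mul] at h1
  -- The cutoff k ≤ L - √(L/d) is exactly what keeps the L - k remaining sections worth at least
  -- √(dL) signs; this term sets the order of ι₁.
  have hsq : Real.sqrt (d * L) ≤ d * ((L : ℝ) - k) := by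
    have e : Real.sqrt (d * L) = d * Real.sqrt (L / d) := by
      rw [Real.sqrt_eq_iff_mul_self_eq (by positivity) (by positivity)]
      have := Real.mul_self_sqrt (by positivity : (0 : ℝ) ≤ L / d)
      calc (d * L : ℝ) = d * d * (Real.sqrt (L / d) * Real.sqrt (L / d)) := by
            rw [this]; field_simp
        _ = _ := by ring
    rw [e]
    exact mul_le_mul_of_nonneg_left (by linarith [hk.2]) (by linarith)
  calc _ ≤ Real.exp (K / (d * k) + K / (d * ((L : ℝ) - k))) * Real.exp (eta / (d * k)) *
        Real.exp (eta / (d * ((L : ℝ) - k))) := by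
        have e1 := Real.add_one_le_exp (eta / (d * k : ℝ))
        have e2 := Real.add_one_le_exp (eta / (d * ((L : ℝ) - k)))
        gcongr
        · linarith
        · linarith
    _ = Real.exp ((K + eta) / (d * k) + (K + eta) / (d * ((L : ℝ) - k))) := by
        rw [← Real.exp_add, ← Real.exp_add]; congr 1; ring
    _ ≤ _ := by
      refine Real.exp_le_exp.2 ?_
      rw [add_div _ (K + eta) (Real.sqrt _)]
      refine add_le_add ?_ ?_
      · rw [div_div]
        refine div_le_div_of_nonneg_left (by positivity) (by positivity) ?_
        nlinarith [hk.1]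
      · exact div_le_div_of_nonneg_left (by positivity) (by positivity) hsq

theorem one_div_sqrt_one_sub_le {x : ℝ} (hx : 0 ≤ x) (hx1 : x ≤ 3 / 4) :
    1 / Real.sqrt (1 - x) ≤ Real.exp (2 * x) := by
  have h1 : 0 < 1 - x := by linarith
  have h2 := Real.one_sub_inv_le_log_of_pos h1
  have h3 : (1 - x)⁻¹ - 1 ≤ 4 * x := by
    have : (1 - x)⁻¹ ≤ 1 + 4 * x := by
      rw [inv_le_iff_one_le_mul₀ h1]; nlinarith
    linarith
  rw [← Real.log_le_iff_le_exp (by positivity), one_div, Real.log_inv, Real.log_sqrt h1.le]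
  linarith

theorem exists_iota₅_le :
    ∃ K : ℝ, 0 ≤ K ∧ ∀ d L : ℕ, 1 ≤ d → 2 ≤ L →
      1 + iota₅ L d ≤ Real.exp (K / Real.sqrt (d * L)) := by
  obtain ⟨K, hK, h⟩ := exists_phi_le
  have heta := eta_nonneg
  refine ⟨2 + 4 * (K + eta), by positivity, fun d L hd hL => ?_⟩
  have hd' : (1 : ℝ) ≤ d := by exact_mod_cast hd
  have hL' : (2 : ℝ) ≤ L := by exact_mod_cast hL
  have hdL : (2 : ℝ) ≤ d * L := by nlinarith
  have hs : Real.sqrt (d * L) ≤ d * L := sqrt_le_self_of_one_le (by linarith)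
  have hs0 : 0 < Real.sqrt (d * L) := by positivity
  -- Since dL ≥ 2, √(dL) ≥ 4/3, which keeps 1 - 1/√(dL) away from 0. Likewise L ≤ (9/16)L² below
  -- gives k ≥ L/4 on this range, so no α₀ is needed.
  have hx : 1 / Real.sqrt (d * L) ≤ 3 / 4 := by
    have : 4 / 3 ≤ Real.sqrt (d * L) := Real.le_sqrt_of_sq_le (by linarith)
    rw [div_le_div_iff₀ hs0 (by norm_num)]
    linarith
  have hLs : Real.sqrt (L / d) ≤ 3 / 4 * L := by
    refine Real.sqrt_le_iff.2 ⟨by positivity, ?_⟩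
    have : (L : ℝ) / d ≤ L := div_le_self (by linarith) hd'
    nlinarith
  have hc := one_div_sqrt_one_sub_le (by positivity) hx
  rw [iota₅, add_sub_cancel]
  refine maxOver_le (Real.one_le_exp (by positivity)) fun k _ hk => ?_
  have hk4 : (L : ℝ) / 4 ≤ k := by linarith [hk.1]
  have hk0 : (0 : ℝ) < k := by linarith
  have hkn : k ≠ 0 := by rintro rfl; simp at hk0
  have h1 := h (d * k) (Nat.mul_ne_zero (by omega) hkn)
  rw [Nat.cast_mul] at h1
  rw [div_eq_mul_one_div]
  calc _ ≤ Real.exp (K / (d * k)) * Real.exp (2 * (1 / Real.sqrt (d * L))) *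
        Real.exp (eta / (d * k)) := by
        have e1 := Real.add_one_le_exp (eta / (d * k : ℝ))
        gcongr
        linarith
    _ = Real.exp (2 / Real.sqrt (d * L) + (K + eta) / (d * k)) := by
        rw [← Real.exp_add, ← Real.exp_add]; congr 1; ring
    _ ≤ _ := by
      refine Real.exp_le_exp.2 ?_
      rw [add_div _ _ (Real.sqrt _)]
      refine add_le_add le_rfl ?_
      rw [div_le_div_iff₀ (by positivity) hs0]
      have : Real.sqrt (d * L) ≤ 4 * (d * k) := by nlinarith
      nlinarith [mul_le_mul_of_nonneg_left this (by positivity : 0 ≤ K + eta)]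

theorem exists_abs_iota₁_le {v α₀ : ℝ} (hv : 0 < v) (hα : 0 < α₀) :
    ∃ K : ℝ, ∀ d L : ℕ, 1 ≤ d → 2 ≤ L → |iota₁ L d v α₀| ≤ K / Real.sqrt (d * L) := by
  obtain ⟨K₃, hK₃, h₃⟩ := exists_iota₃_le hv hα
  obtain ⟨K₄, hK₄, h₄⟩ := exists_iota₄_le hα
  obtain ⟨K₅, hK₅, h₅⟩ := exists_iota₅_le
  refine ⟨K₃ + (K₄ + K₅), fun d L hd hL => ?_⟩
  have a₃ := one_le_iota₃ L d hv.le α₀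
  have a₄ := one_le_one_add_max (L := L) (d := d) α₀
  have hs0 : 0 ≤ Real.sqrt (d * L) := Real.sqrt_nonneg _
  have hmax : 1 + max (iota₄ L d α₀) (iota₅ L d) ≤ Real.exp ((K₄ + K₅) / Real.sqrt (d * L)) := by
    rcases max_choice (iota₄ L d α₀) (iota₅ L d) with e | e <;> rw [e]
    · exact (h₄ d L hd hL).trans (Real.exp_le_exp.2 (div_le_div_of_nonneg_right (by linarith) hs0))
    · exact (h₅ d L hd hL).trans (Real.exp_le_exp.2 (div_le_div_of_nonneg_right (by linarith) hs0))
  have hone := one_le_mul_of_one_le_of_one_le a₃ a₄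
  rw [iota₁, abs_of_nonneg (Real.log_nonneg hone), Real.log_le_iff_le_exp (by linarith), add_div,
    Real.exp_add]
  exact mul_le_mul (h₃ d L hd hL) hmax (by linarith) (Real.exp_pos _).le

/-! ### The error probability -/

/-- Minimality of the decoded word gives ‖Y - Xβ'‖² ≤ ‖Y - Xβ‖². Subtracting the same reference term
from both sides, if the sent word's statistic is below nt, so is the rival's. The reference depends
only on the sent word and the noise, hence is shared by all rivals. -/
theorem mistakeEvent_subset {n L M d l : ℕ} {σ B α t : ℝ} (hσ : 0 < σ) {β : Col L M → ℝ}
    (hβ : β ∈ messages L M) {f : Fin L → Fin M}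
    (hf : ∀ s m, β (s, m) = if m = f s then 1 else 0)
    {dec : Matrix (Fin n) (Col L M) ℝ → (Fin n → ℝ) → (Col L M → ℝ)} (hdec : IsMLDecoder dec) :
    mistakeEvent d dec β l ⊆
      {ω | n * t ≤ ∑ i, (ω.2 i ^ 2 / (2 * σ ^ 2) -
        (ω.2 i + α * ∑ p ∈ signIndices d Finset.univ f, ω.1 i p) ^ 2 / (2 * B))} ∪
      ⋃ D ∈ Finset.powersetCard l (Finset.univ : Finset (Fin L)),
        {ω | ∃ f' ∈ rivals D f, ∑ i, (
          (ω.2 i + ∑ p ∈ signIndices d D f, ω.1 i p - ∑ p ∈ signIndices d D f', ω.1 i p) ^ 2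
            / (2 * σ ^ 2) -
          (ω.2 i + α * (∑ p ∈ signIndices d D f, ω.1 i p + ∑ p ∈ signIndices d Dᶜ f, ω.1 i p)) ^ 2
            / (2 * B)) ≤ n * t} := by
  intro ω hω
  obtain ⟨hmem, hmin⟩ := hdec (dictionary ω) (output β ω) ⟨β, hβ⟩
  obtain ⟨f', hf'⟩ := exists_selection hmem
  have hcard : (Finset.univ.filter fun s => f' s ≠ f s).card = l := by
    rw [← mistakes_eq hf hf']; exact hω
  set D := Finset.univ.filter fun s => f' s ≠ f s with hD
  by_cases hT : n * t ≤ ∑ i, (ω.2 i ^ 2 / (2 * σ ^ 2) -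
        (ω.2 i + α * ∑ p ∈ signIndices d Finset.univ f, ω.1 i p) ^ 2 / (2 * B))
  · exact Or.inl hT
  refine Or.inr ?_
  have hDc : ∀ s ∈ Dᶜ, f' s = f s := fun s hs => by simpa [hD] using hs
  simp only [Set.mem_iUnion, exists_prop]
  refine ⟨D, Finset.mem_powersetCard.2 ⟨Finset.subset_univ _, hcard⟩, f', ?_, ?_⟩
  · simp only [rivals, Finset.mem_filter, Finset.mem_univ, true_and]
    exact ⟨fun s hs => by simpa [hD] using hs, hDc⟩
  · have h := hmin β hβ
    have hY : ∀ i, ∑ p ∈ signIndices d Dᶜ f', ω.1 i p = ∑ p ∈ signIndices d Dᶜ f, ω.1 i p := by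
      intro i
      rw [sum_signIndices, sum_signIndices]
      exact Finset.sum_congr rfl fun s hs => by rw [hDc s hs]
    have h1 : sqNorm (output β ω - (dictionary ω).mulVec (dec (dictionary ω) (output β ω))) =
        ∑ i, (ω.2 i + ∑ p ∈ signIndices d D f, ω.1 i p
          - ∑ p ∈ signIndices d D f', ω.1 i p) ^ 2 := by
      refine Finset.sum_congr rfl fun i _ => ?_
      rw [Pi.sub_apply, dictionary_mulVec hf', output, Pi.add_apply, dictionary_mulVec hf,
        sum_signIndices_univ D f, sum_signIndices_univ D f', hY]
      ring
    have h2 : sqNorm (output β ω - (dictionary ω).mulVec β) = ∑ i, ω.2 i ^ 2 := by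
      refine Finset.sum_congr rfl fun i _ => ?_
      rw [output, add_sub_cancel_left]
    rw [h1, h2] at h
    have h3 := div_le_div_of_nonneg_right h (by positivity : 0 ≤ 2 * σ ^ 2)
    rw [Finset.sum_div, Finset.sum_div] at h3
    simp_rw [sum_signIndices_univ D f] at hT
    rw [Finset.sum_sub_distrib] at hT ⊢
    linarith

theorem jointLaw_sent_le_exp {n L M d : ℕ} {P σ v α : ℝ} (hn : n ≠ 0) (hL : 2 ≤ L) (hd : 1 ≤ d)
    (hP : 0 < P) (hσ : 0 < σ) (hv : v = P / σ ^ 2) (hα : 0 < α) (f : Fin L → Fin M) (t : ℝ) :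
    jointLaw n L M d P σ {ω | n * t ≤ ∑ i, (ω.2 i ^ 2 / (2 * σ ^ 2) -
        (ω.2 i + α * ∑ p ∈ signIndices d Finset.univ f, ω.1 i p) ^ 2
          / (2 * (σ ^ 2 + α ^ 2 * P)))} ≤
      ENNReal.ofReal (Real.exp (-(n * (expD t (α ^ 2 * v / (1 + α ^ 2 * v)) - iota₂ L d)))) := by
  have hq : α ^ 2 * v / (1 + α ^ 2 * v) = α ^ 2 * P / (σ ^ 2 + α ^ 2 * P) := by
    rw [hv]; field_simp
  have heta := eta_nonneg
  have hd' : (0 : ℝ) < d := by exact_mod_cast hd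
  have hL' : (0 : ℝ) < L := by exact_mod_cast (by omega : 0 < L)
  refine le_ofReal_exp_csSup hn ⟨(0 : ℝ), by simp⟩ ?_
  rintro lam ⟨hl0, hl⟩
  have hl' := hl
  rw [hq] at hl' ⊢
  refine (jointLaw_sent_le hL hd hP hσ hα f t hl0 hl').trans (ENNReal.ofReal_le_ofReal ?_)
  have hF : 0 < Real.exp (phi (d * L)) * (1 + eta / (d * L)) := by positivity
  rw [← Real.log_le_log_iff (by positivity) (Real.exp_pos _), Real.log_exp, Real.log_pow,
    Real.log_mul (by positivity) (by positivity), Real.log_mul (Real.exp_pos _).ne' hF.ne',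
    Real.log_mul (Real.exp_pos _).ne' (by positivity), Real.log_exp, Real.log_exp, one_div,
    Real.log_inv, Real.log_sqrt hl'.le, iota₂]
  -- A single η suffices; the 2 in ι₂ is slack.
  have : Real.log (1 + eta / (d * L)) ≤ Real.log (1 + 2 * eta / (d * L)) := by
    refine Real.log_le_log (by positivity) ?_
    gcongr
    linarith
  have := mul_le_mul_of_nonneg_left this (Nat.cast_nonneg (α := ℝ) n)
  linarith

theorem lintegral_exp_decoding_le_iota {L d l : ℕ} {P s α α₀ lam : ℝ} (hL : 2 ≤ L) (hd : 1 ≤ d)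
    (hP : 0 < P) (hs : 0 < s) (hl0 : l ≠ 0) (hlL : l ≤ L) (hα : α = (l : ℝ) / L) (hα₀ : α₀ ≤ α)
    (hlam0 : 0 ≤ lam) (hlam1 : lam ≤ 1) :
    ∫⁻ e, ∫⁻ y, ∫⁻ x, ENNReal.ofReal (Real.exp (lam *
        ((e + α * (x + y)) ^ 2 / (2 * (s + α ^ 2 * P)) -
          (e + x) ^ 2 / (2 * (s + α * P)))))
        ∂binLaw (Real.sqrt (P / (d * L))) (d * l) ∂binLaw (Real.sqrt (P / (d * L))) (d * (L - l))
        ∂normalLaw s ≤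
      ENNReal.ofReal ((1 + max (iota₄ L d α₀) (iota₅ L d)) *
        (1 / Real.sqrt (1 - lam ^ 2 * (α * (1 - α) * P / (s + α * P))))) := by
  have hL' : (0 : ℝ) < L := by exact_mod_cast (by omega : 0 < L)
  have hd' : (0 : ℝ) < d := by exact_mod_cast hd
  have hl' : (0 : ℝ) < l := by positivity
  have hα0 : 0 < α := by rw [hα]; positivity
  have hmax := one_le_one_add_max (L := L) (d := d) α₀
  rcases hlL.eq_or_lt with rfl | hlt
  -- With every section wrong there are no common columns: y = 0 and the two quadratic terms cancel,
  -- so the moment is 1.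
  · have hα1 : α = 1 := by rw [hα, div_self hL'.ne']
    rw [hα1]
    simpa [binLaw, one_le_div] using hmax
  · have hα1 : α < 1 := by
      rw [hα, div_lt_one hL']; exact_mod_cast hlt
    have h₂ : ((d * (L - l) : ℕ) : ℝ) * Real.sqrt (P / (d * L)) ^ 2 = (1 - α) * P := by
      rw [sqrt_div_sq hP hd hL, Nat.cast_sub hlL, hα]; field_simp
    have hα₀' : α₀ * L ≤ l := by
      have := mul_le_mul_of_nonneg_right hα₀ hL'.le
      rwa [hα, div_mul_cancel₀ _ hL'.ne'] at this
    refine (lintegral_exp_decoding_le (by positivity) hP hs hα0 hα1 hlam0 hlam1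
      (Nat.mul_ne_zero (by omega) hl0) (by rw [sqrt_div_sq hP hd hL, hα]) h₂).trans ?_
    rw [ENNReal.ofReal_mul (p := 1 + max (iota₄ L d α₀) (iota₅ L d)) (by linarith)]
    refine mul_le_mul_left (ENNReal.ofReal_le_ofReal ?_) _
    rw [Nat.cast_mul]
    exact exp_phi_mul_le_of_lt hd hL hlt hα₀'

theorem jointLaw_decoding_le_exp {n L M d l : ℕ} {P σ v R α₀ α t : ℝ} (hn : n ≠ 0) (hL : 2 ≤ L)
    (hd : 1 ≤ d) (hP : 0 < P) (hσ : 0 < σ) (hv : v = P / σ ^ 2) (hR : R = rate n L M)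
    (hl0 : l ≠ 0) (hlL : l ≤ L) (hα : α = (l : ℝ) / L) (hα₀ : α₀ ≤ α) (hM : 0 < M)
    (f : Fin L → Fin M) {D : Finset (Fin L)} (hD : D.card = l) :
    jointLaw n L M d P σ {ω | ∃ f' ∈ rivals D f, ∑ i, (
        (ω.2 i + ∑ p ∈ signIndices d D f, ω.1 i p - ∑ p ∈ signIndices d D f', ω.1 i p) ^ 2
          / (2 * σ ^ 2) -
        (ω.2 i + α * (∑ p ∈ signIndices d D f, ω.1 i p + ∑ p ∈ signIndices d Dᶜ f, ω.1 i p)) ^ 2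
          / (2 * (σ ^ 2 + α ^ 2 * P))) ≤ n * t} ≤
      ENNReal.ofReal (Real.exp (-(n * (expD₁ (partialCapacity v α - α * R - t)
        (α * (1 - α) * v / (1 + α * v)) - iota₁ L d v α₀)))) := by
  have hL' : (0 : ℝ) < L := by exact_mod_cast (by omega : 0 < L)
  have hd' : (0 : ℝ) < d := by exact_mod_cast hd
  have hl' : (0 : ℝ) < l := by positivity
  have hn' : (0 : ℝ) < n := by positivity
  have hM' : (0 : ℝ) < M := by exact_mod_cast hM
  have hα0 : 0 < α := by rw [hα]; positivity
  have hα1 : α ≤ 1 := by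
    rw [hα, div_le_one hL']; exact_mod_cast hlL
  have hv0 : 0 < v := by rw [hv]; positivity
  have hs : 0 < σ ^ 2 := by positivity
  have heta := eta_nonneg
  have hα₀' : α₀ * L ≤ l := by
    have := mul_le_mul_of_nonneg_right hα₀ hL'.le
    rwa [hα, div_mul_cancel₀ _ hL'.ne'] at this
  have hq : α * (1 - α) * v / (1 + α * v) = α * (1 - α) * P / (σ ^ 2 + α * P) := by
    rw [hv]; field_simp
  have hvα : α * P / σ ^ 2 = α * v := by rw [hv]; ring
  set F := Real.exp (phi (d * l)) * (1 + eta * (1 + α * P / σ ^ 2) / (d * l)) with hF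
  have hF1 : 1 ≤ F := by
    refine one_le_mul_of_one_le_of_one_le (one_le_exp_phi _) ?_
    have : 0 ≤ eta * (1 + α * P / σ ^ 2) / (d * l) := by positivity
    linarith
  have hF3 : F ≤ 1 + iota₃ L d v α₀ := by
    refine le_trans ?_ (le_of_le_of_eq (le_maxOver (f := fun k => Real.exp (phi (d * k)) *
      (1 + eta * (1 + v) / (d * k))) (p := fun k => α₀ * L ≤ k) hlL hα₀')
      (by rw [iota₃, add_sub_cancel]))
    rw [hF, hvα]
    have : α * v ≤ v := mul_le_of_le_one_left hv0.le hα1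
    gcongr
  have hmax := one_le_one_add_max (L := L) (d := d) α₀
  set F₄ := 1 + max (iota₄ L d α₀) (iota₅ L d) with hF₄
  refine le_ofReal_exp_csSup hn ⟨(0 : ℝ), by simp⟩ ?_
  rintro lam ⟨⟨hlam0, hlam1⟩, hlam⟩
  rw [hq] at hlam ⊢
  have hψ := lintegral_exp_decoding_le_iota hL hd hP hs hl0 hlL hα hα₀ hlam0 hlam1
  rw [← hF₄] at hψ
  have hψ0 : 0 < F₄ * (1 / Real.sqrt (1 - lam ^ 2 * (α * (1 - α) * P / (σ ^ 2 + α * P)))) := by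
    have : 0 < F₄ := by linarith
    positivity
  refine (jointLaw_decoding_le hL hd hP hσ hl0 hα hM f hD t hlam0 hlam1 hψ0.le hF hψ).trans
    (ENNReal.ofReal_le_ofReal ?_)
  have hF0 : 0 < F := by linarith
  have hF₄0 : 0 < F₄ := by linarith
  have hαv : 0 < 1 + α * v := by positivity
  have hsq : 0 < Real.sqrt (1 + α * v) := Real.sqrt_pos.2 hαv
  have hG : 0 < (M : ℝ) ^ l * Real.exp (n * t) * (F / Real.sqrt (1 + α * v)) ^ n := by positivity
  rw [hvα, ← Real.log_le_log_iff (mul_pos (Real.rpow_pos_of_pos hG _) (pow_pos hψ0 n))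
    (Real.exp_pos _), Real.log_exp, Real.log_mul (Real.rpow_pos_of_pos hG _).ne'
    (pow_pos hψ0 n).ne', Real.log_rpow hG, Real.log_mul (by positivity) (by positivity),
    Real.log_mul (by positivity) (by positivity), Real.log_exp, Real.log_pow, Real.log_pow,
    Real.log_pow, Real.log_div hF0.ne' hsq.ne', Real.log_mul hF₄0.ne' (by positivity), one_div,
    Real.log_inv, Real.log_sqrt hlam.le, Real.log_sqrt hαv.le, iota₁, ← hF₄,
    Real.log_mul (by linarith) hF₄0.ne', partialCapacity]
  -- The number of rivals is at most M^l = e^(nαR); together with e^(nt) and (1 + αv)^(-n/2) it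
  -- makes up -nΔ_α, multiplied by λ.
  have hnR : (n : ℝ) * (α * R) = l * Real.log M := by
    rw [hR, rate, hα]; field_simp
  -- The correction enters to the power λ; as F ≥ 1 and λ ≤ 1 it is bounded uniformly in λ and can
  -- leave the supremum.
  have hlogF : lam * Real.log F ≤ Real.log (1 + iota₃ L d v α₀) :=
    (mul_le_of_le_one_left (Real.log_nonneg hF1) hlam1).trans (Real.log_le_log hF0 hF3)
  have hlogF' := mul_le_mul_of_nonneg_left hlogF hn'.le
  rw [← hnR]
  linarith

theorem jointLaw_mistakeEvent_le {n L M d l : ℕ} {P σ v R α₀ α : ℝ} (hn : n ≠ 0) (hL : 2 ≤ L)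
    (hd : 1 ≤ d) (hP : 0 < P) (hσ : 0 < σ) (hv : v = P / σ ^ 2) (hR : R = rate n L M)
    (hα₀ : 0 < α₀) (hlL : l ≤ L) (hα : α = (l : ℝ) / L) (hα₀α : α₀ ≤ α) {β : Col L M → ℝ}
    (hβ : β ∈ messages L M) {dec : Matrix (Fin n) (Col L M) ℝ → (Fin n → ℝ) → (Col L M → ℝ)}
    (hdec : IsMLDecoder dec) (t : ℝ) :
    jointLaw n L M d P σ (mistakeEvent d dec β l) ≤
      ENNReal.ofReal (errBin n L d l v α₀ R α t) := by
  obtain ⟨f, hf⟩ := exists_selection hβ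
  have hα0 : 0 < α := hα₀.trans_le hα₀α
  have hl0 : l ≠ 0 := by
    rintro rfl
    simp at hα
    exact hα0.ne' hα
  have hM : 0 < M := (Nat.zero_le _).trans_lt (f ⟨0, by omega⟩).isLt
  refine (measure_mono (mistakeEvent_subset (B := σ ^ 2 + α ^ 2 * P) (α := α) (t := t) hσ hβ hf
    hdec)).trans ((measure_union_le _ _).trans ?_)
  rw [errBin, ENNReal.ofReal_add (by positivity) (by positivity), add_comm]
  refine add_le_add ?_ (jointLaw_sent_le_exp hn hL hd hP hσ hv hα0 f t)
  refine (measure_biUnion_finset_le _ _).trans ?_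
  refine (Finset.sum_le_sum fun D hD => jointLaw_decoding_le_exp hn hL hd hP hσ hv hR hl0 hlL hα
    hα₀α hM f (Finset.mem_powersetCard.1 hD).2).trans ?_
  rw [Finset.sum_const, Finset.card_powersetCard, Finset.card_univ, Fintype.card_fin, nsmul_eq_mul,
    ENNReal.ofReal_mul (by positivity), ENNReal.ofReal_natCast]

end

end SuperpositionCode

theorem lemma2 :
    (∀ (n L M d l : ℕ) (P σ v R α₀ α : ℝ),
      1 ≤ n → 2 ≤ L → 1 ≤ d → 0 < P → 0 < σ → v = P / σ ^ 2 →
      R = SuperpositionCode.rate n L M →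
      0 < α₀ → α₀ ≤ 1 → l ≤ L → α = (l : ℝ) / L → α₀ ≤ α →
      α * R ≤ SuperpositionCode.partialCapacity v α →
      ∀ β ∈ SuperpositionCode.messages L M,
      ∀ dec : Matrix (Fin n) (SuperpositionCode.Col L M) ℝ → (Fin n → ℝ) →
          (SuperpositionCode.Col L M → ℝ),
      SuperpositionCode.IsMLDecoder dec →
      ∃ m : ℝ,
        IsLeast ((fun t : ℝ => SuperpositionCode.errBin n L d l v α₀ R α t) ''
          Set.Icc 0 (SuperpositionCode.partialCapacity v α - α * R)) m ∧
        SuperpositionCode.jointLaw n L M d P σ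
          (SuperpositionCode.mistakeEvent d dec β l) ≤ ENNReal.ofReal m) ∧
    (∀ v α₀ : ℝ, 0 < v → 0 < α₀ → α₀ ≤ 1 →
      ∃ K : ℝ, ∀ d L : ℕ, 1 ≤ d → 2 ≤ L →
        |SuperpositionCode.iota₁ L d v α₀| ≤ K / Real.sqrt (d * L)) ∧
    (∃ K : ℝ, ∀ d L : ℕ, 1 ≤ d → 2 ≤ L →
      |SuperpositionCode.iota₂ L d| ≤ K / (d * L)) := by
  refine ⟨?_, fun v α₀ hv hα₀ _ => SuperpositionCode.exists_abs_iota₁_le hv hα₀,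
    SuperpositionCode.exists_abs_iota₂_le⟩
  intro n L M d l P σ v R α₀ α hn hL hd hP hσ hv hR hα₀ _ hlL hα hα₀α hC β hβ dec hdec
  have hv0 : 0 < v := by rw [hv]; positivity
  have hα1 : α ≤ 1 := by
    rw [hα]
    exact div_le_one_of_le₀ (by exact_mod_cast hlL) (by positivity)
  -- The probability bound holds for every real t, so it holds at the minimizer.
  obtain ⟨t, -, ht⟩ := SuperpositionCode.exists_isLeast_errBin n L d l α₀ R hv0
    (hα₀.trans_le hα₀α) hα1 hC
  exact ⟨_, ht, SuperpositionCode.jointLaw_mistakeEvent_le (by omega) hL hd hP hσ hv hR hα₀ hlL hα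
    hα₀α hβ hdec t⟩
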